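/- Let $p\ge 4$, let $\alpha\in\mathbb C$ be a primitive $p$-th root of unity, let $U\subset\mathbb C^2$ be an open set containing the origin, and let $F:U\to\mathbb C^2$ be a complex-smooth (that is, holomorphic) map whose Taylor expansion at the origin is $$F(x,y)=\Bigl(\alpha x+\sum_{i+j\ge 2}f_{i,j}x^iy^j,\ \frac1\alpha\,y+\sum_{i+j\ge 2}g_{i,j}x^iy^j\Bigr).$$ Suppose that $F$ is $p$-periodic, i.e. $p$ is the smallest positive integer such that $F^p(z)=z$ for every $z$ at which the iterate $F^p$ is well defined (that is, $z,F(z),\dots,F^{p-1}(z)\in U$). Then $\mathcal P_1(F)=\mathcal P_2(F)=0$, and if moreover $p\ge5$ then also $\mathcal P_3(F)=0$, where \begin{align*} \mathcal P_1(F)={}&(f_{2,1}+f_{1,1}g_{1,1})\alpha^4-f_{1,1}(2f_{2,0}-g_{1,1})\alpha^3+(2g_{2,0}f_{0,2}-f_{1,1}f_{2,0}+f_{1,1}g_{1,1})\alpha^2\\ &-(f_{2,1}+f_{1,1}f_{2,0})\alpha+f_{1,1}f_{2,0},\\ \mathcal P_2(F)={}&g_{0,2}g_{1,1}\alpha^4-(g_{1,2}+g_{0,2}g_{1,1})\alpha^3+(f_{1,1}g_{1,1}+2g_{2,0}f_{0,2}-g_{0,2}g_{1,1})\alpha^2\\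 &+g_{1,1}(-2g_{0,2}+f_{1,1})\alpha+f_{1,1}g_{1,1}+g_{1,2}, \end{align*} and \begin{align*} \mathcal P_3(F)={}&{}\bigl(f_{1,1}g_{0,2}g_{1,1}^{2}\bigr)\alpha^{17}\\ &+\bigl(2f_{1,1}g_{0,2}g_{1,1}^{2}-f_{3,1}g_{0,2}-f_{1,1}g_{1,1}g_{1,2}-f_{1,1}g_{0,2}g_{2,1}\bigr)\alpha^{16}\\ &+\bigl(f_{3,2}+3f_{1,1}g_{0,2}g_{1,1}^{2}+3f_{1,1}f_{3,0}g_{0,2}-3f_{1,1}g_{0,2}g_{2,1}+2f_{1,1}f_{2,0}g_{0,2}g_{1,1}+2f_{1,1}^{2}g_{0,2}g_{2,0}-2f_{3,1}g_{0,2}\\ &\quad +2f_{2,0}f_{2,1}g_{0,2}+f_{1,2}g_{1,1}^{2}+2f_{2,2}g_{1,1}+f_{1,1}g_{2,2}+2f_{0,2}f_{1,1}g_{1,1}g_{2,0}-f_{1,1}g_{1,1}g_{1,2}+f_{1,1}^{2}g_{1,1}^{2}\bigr)\alpha^{15}\\ &+\bigl(3f_{1,1}g_{0,2}g_{1,1}^{2}+6f_{1,1}f_{3,0}g_{0,2}-6f_{0,2}f_{3,0}g_{1,1}-4f_{1,2}f_{2,0}g_{1,1}-3f_{1,1}f_{2,1}g_{1,1}+2f_{1,2}g_{2,1}-3f_{1,2}f_{3,0}\\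 &\quad +5f_{1,2}g_{1,1}^{2}+2f_{1,1}^{2}g_{1,1}^{2}+2f_{0,2}f_{1,1}g_{1,1}g_{2,0}-2f_{2,0}f_{2,2}-2f_{1,1}^{2}g_{2,1}-3f_{3,1}g_{0,2}-2f_{1,1}g_{0,2}^{2}g_{2,0}\\ &\quad +3f_{1,1}f_{2,0}g_{0,2}g_{1,1}+4f_{2,0}f_{2,1}g_{0,2}-3f_{0,2}f_{1,1}g_{3,0}-2f_{1,2}g_{0,2}g_{2,0}+4f_{2,2}g_{1,1}+f_{3,2}+2f_{0,2}g_{1,1}^{3}\\ &\quad +2f_{0,2}g_{1,1}g_{2,1}-4f_{1,1}f_{2,0}^{2}g_{0,2}-4f_{1,1}g_{0,2}g_{2,1}+6f_{1,1}^{2}g_{0,2}g_{2,0}-3f_{1,1}f_{3,1}-2f_{1,1}f_{2,0}g_{1,2}-2f_{1,1}f_{1,2}g_{2,0}\\ &\quad -4f_{0,2}f_{4,0}-2f_{0,2}f_{2,0}g_{1,1}^{2}+2f_{1,1}g_{2,2}\bigr)\alpha^{14}\\ &+\bigl(4f_{1,1}f_{2,0}f_{2,1}+4f_{1,1}g_{0,2}g_{1,1}^{2}+11f_{1,1}f_{3,0}g_{0,2}-12f_{0,2}f_{3,0}g_{1,1}+6f_{1,1}^{2}f_{2,0}g_{1,1}-10f_{1,2}f_{2,0}g_{1,1}-8f_{1,1}f_{2,1}g_{1,1}\\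 &\quad +2f_{1,2}g_{2,1}-3f_{1,2}f_{3,0}+4f_{1,2}f_{2,0}^{2}+3f_{1,1}^{3}g_{2,0}+10f_{1,2}g_{1,1}^{2}+f_{1,1}^{2}g_{1,1}^{2}+6f_{1,1}^{2}f_{3,0}\\ &\quad -4f_{0,2}f_{1,1}g_{1,1}g_{2,0}-2f_{2,0}f_{2,2}-7f_{1,1}^{2}g_{2,1}+12f_{0,2}f_{2,0}f_{3,0}+4f_{0,2}f_{2,0}g_{0,2}g_{2,0}-f_{3,1}g_{0,2}-2f_{0,2}g_{0,2}g_{3,0}\\ &\quad -6f_{1,1}g_{0,2}^{2}g_{2,0}+8f_{0,2}f_{1,1}f_{2,0}g_{2,0}+6f_{2,0}f_{2,1}g_{0,2}-6f_{0,2}f_{1,1}g_{3,0}-4f_{1,2}g_{0,2}g_{2,0}+6f_{2,2}g_{1,1}+f_{3,2}\\ &\quad +6f_{0,2}g_{1,1}^{3}+3f_{1,1}g_{0,3}g_{2,0}+6f_{0,2}g_{1,1}g_{2,1}+6f_{0,3}g_{1,1}g_{2,0}-8f_{1,1}f_{2,0}^{2}g_{0,2}-3f_{1,1}g_{0,2}g_{2,1}+5f_{1,1}g_{1,1}g_{1,2}\\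 &\quad +8f_{0,2}f_{2,0}^{2}g_{1,1}+11f_{1,1}^{2}g_{0,2}g_{2,0}-5f_{1,1}f_{3,1}-5f_{1,1}f_{2,0}g_{1,2}+3f_{1,3}g_{2,0}-8f_{1,1}f_{1,2}g_{2,0}-4f_{0,2}f_{4,0}\\ &\quad -12f_{0,2}f_{2,0}g_{1,1}^{2}+2f_{0,2}g_{3,1}-4f_{0,2}f_{2,0}g_{2,1}+3f_{1,1}g_{2,2}\bigr)\alpha^{13}\\ &+\bigl(6f_{1,1}f_{2,0}f_{2,1}+9f_{1,1}g_{0,2}g_{1,1}^{2}+7f_{1,1}f_{3,0}g_{0,2}-24f_{0,2}f_{3,0}g_{1,1}+19f_{1,1}^{2}f_{2,0}g_{1,1}-16f_{1,2}f_{2,0}g_{1,1}-15f_{1,1}f_{2,1}g_{1,1}\\ &\quad +4f_{1,2}g_{2,1}-5f_{1,2}f_{3,0}-8f_{0,2}f_{2,0}^{3}+4f_{1,2}f_{2,0}^{2}+12f_{1,1}^{3}g_{2,0}+15f_{1,2}g_{1,1}^{2}-5f_{1,1}^{2}g_{1,1}^{2}\\ &\quad +12f_{1,1}^{2}f_{3,0}+3f_{0,3}g_{3,0}-33f_{0,2}f_{1,1}g_{1,1}g_{2,0}-2f_{2,0}f_{2,2}-13f_{1,1}^{2}g_{2,1}+12f_{0,2}f_{2,0}f_{3,0}+12f_{0,2}f_{2,0}g_{0,2}g_{2,0}\\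 &\quad +2f_{3,1}g_{0,2}-4f_{0,2}g_{0,2}g_{3,0}-8f_{1,1}g_{0,2}^{2}g_{2,0}-6f_{0,2}f_{2,1}g_{2,0}+26f_{0,2}f_{1,1}f_{2,0}g_{2,0}-14f_{1,1}f_{2,0}g_{0,2}g_{1,1}+2f_{2,0}f_{2,1}g_{0,2}\\ &\quad -15f_{0,2}f_{1,1}g_{3,0}-2f_{1,2}g_{0,2}g_{2,0}+2f_{2,2}g_{1,1}-2f_{3,2}+16f_{0,2}g_{1,1}^{3}+6f_{1,1}g_{0,3}g_{2,0}+14f_{0,2}g_{1,1}g_{2,1}\\ &\quad +12f_{0,3}g_{1,1}g_{2,0}-14f_{1,1}f_{2,0}^{2}g_{0,2}+3f_{1,1}g_{0,2}g_{2,1}+9f_{1,1}g_{1,1}g_{1,2}+20f_{0,2}f_{2,0}^{2}g_{1,1}-6f_{1,1}^{2}f_{2,0}^{2}+10f_{1,1}^{2}g_{0,2}g_{2,0}\\ &\quad -7f_{1,1}f_{3,1}-9f_{1,1}f_{2,0}g_{1,2}+3f_{1,3}g_{2,0}-19f_{1,1}f_{1,2}g_{2,0}-6f_{0,3}f_{2,0}g_{2,0}-4f_{0,2}f_{4,0}-30f_{0,2}f_{2,0}g_{1,1}^{2}\\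 &\quad +2f_{0,2}g_{3,1}-8f_{0,2}f_{2,0}g_{2,1}+4f_{0,2}g_{0,2}g_{1,1}g_{2,0}+f_{1,1}g_{2,2}\bigr)\alpha^{12}\\ &+\bigl(8f_{1,1}f_{2,0}f_{2,1}+15f_{1,1}g_{0,2}g_{1,1}^{2}+2f_{1,1}f_{3,0}g_{0,2}-18f_{0,2}f_{3,0}g_{1,1}+40f_{1,1}^{2}f_{2,0}g_{1,1}-12f_{1,2}f_{2,0}g_{1,1}-15f_{1,1}f_{2,1}g_{1,1}\\ &\quad -2f_{1,2}g_{2,1}+4f_{1,2}f_{3,0}-8f_{0,2}f_{2,0}^{3}+6f_{1,2}f_{2,0}^{2}+29f_{1,1}^{3}g_{2,0}+11f_{1,2}g_{1,1}^{2}-16f_{1,1}^{2}g_{1,1}^{2}\\ &\quad +21f_{1,1}^{2}f_{3,0}+3f_{0,3}g_{3,0}-74f_{0,2}f_{1,1}g_{1,1}g_{2,0}+4f_{2,0}f_{2,2}-16f_{1,1}^{2}g_{2,1}+16f_{0,2}f_{2,0}f_{3,0}+12f_{0,2}f_{2,0}g_{0,2}g_{2,0}\\ &\quad +5f_{3,1}g_{0,2}-6f_{0,2}g_{0,2}g_{3,0}-8f_{1,1}g_{0,2}^{2}g_{2,0}-6f_{0,2}f_{2,1}g_{2,0}+70f_{0,2}f_{1,1}f_{2,0}g_{2,0}-35f_{1,1}f_{2,0}g_{0,2}g_{1,1}-4f_{2,0}f_{2,1}g_{0,2}\\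 &\quad -19f_{0,2}f_{1,1}g_{3,0}-4f_{2,2}g_{1,1}+4f_{0,2}g_{1,2}g_{2,0}-3f_{3,2}+24f_{0,2}g_{1,1}^{3}+9f_{1,1}g_{0,3}g_{2,0}+14f_{0,2}g_{1,1}g_{2,1}\\ &\quad +18f_{0,3}g_{1,1}g_{2,0}-8f_{1,1}f_{2,0}^{2}g_{0,2}+6f_{1,1}g_{0,2}g_{2,1}+10f_{1,1}g_{1,1}g_{1,2}+40f_{0,2}f_{2,0}^{2}g_{1,1}-10f_{1,1}^{2}f_{2,0}^{2}-3f_{1,1}^{2}g_{0,2}g_{2,0}\\ &\quad -8f_{1,1}f_{2,0}g_{1,2}+3f_{1,3}g_{2,0}-25f_{1,1}f_{1,2}g_{2,0}-12f_{0,3}f_{2,0}g_{2,0}+4f_{0,2}f_{4,0}-54f_{0,2}f_{2,0}g_{1,1}^{2}+2f_{0,2}g_{3,1}\\ &\quad -12f_{0,2}f_{2,0}g_{2,1}+10f_{0,2}g_{0,2}g_{1,1}g_{2,0}-2f_{1,1}g_{2,2}\bigr)\alpha^{11}\\ &+\bigl(-2f_{1,1}f_{2,0}f_{2,1}+22f_{1,1}g_{0,2}g_{1,1}^{2}-9f_{1,1}f_{3,0}g_{0,2}-10f_{0,2}f_{3,0}g_{1,1}+54f_{1,1}^{2}f_{2,0}g_{1,1}+2f_{1,2}f_{2,0}g_{1,1}-8f_{1,1}f_{2,1}g_{1,1}\\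 &\quad -2f_{1,2}g_{2,1}+5f_{1,2}f_{3,0}-12f_{0,2}f_{2,0}^{3}-6f_{1,2}f_{2,0}^{2}+46f_{1,1}^{3}g_{2,0}+4f_{1,2}g_{1,1}^{2}-25f_{1,1}^{2}g_{1,1}^{2}\\ &\quad +13f_{1,1}^{2}f_{3,0}+3f_{0,3}g_{3,0}-115f_{0,2}f_{1,1}g_{1,1}g_{2,0}+6f_{2,0}f_{2,2}-9f_{1,1}^{2}g_{2,1}-8f_{0,2}f_{2,0}f_{3,0}+4f_{0,2}f_{2,0}g_{0,2}g_{2,0}\\ &\quad +5f_{3,1}g_{0,2}+2f_{0,2}g_{0,2}g_{3,0}-6f_{0,2}f_{2,1}g_{2,0}+98f_{0,2}f_{1,1}f_{2,0}g_{2,0}-52f_{1,1}f_{2,0}g_{0,2}g_{1,1}-10f_{2,0}f_{2,1}g_{0,2}-17f_{0,2}f_{1,1}g_{3,0}\\ &\quad +8f_{1,2}g_{0,2}g_{2,0}-10f_{2,2}g_{1,1}+4f_{0,2}g_{1,2}g_{2,0}-3f_{3,2}+32f_{0,2}g_{1,1}^{3}+6f_{1,1}g_{0,3}g_{2,0}+12f_{0,2}g_{1,1}g_{2,1}\\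 &\quad -8f_{0,2}^{2}g_{2,0}^{2}+15f_{0,3}g_{1,1}g_{2,0}+9f_{1,1}g_{0,2}g_{2,1}+5f_{1,1}g_{1,1}g_{1,2}+40f_{0,2}f_{2,0}^{2}g_{1,1}-16f_{1,1}^{2}f_{2,0}^{2}-20f_{1,1}^{2}g_{0,2}g_{2,0}\\ &\quad +7f_{1,1}f_{3,1}-3f_{1,1}f_{2,0}g_{1,2}-3f_{1,3}g_{2,0}-19f_{1,1}f_{1,2}g_{2,0}-12f_{0,3}f_{2,0}g_{2,0}+8f_{0,2}f_{4,0}-62f_{0,2}f_{2,0}g_{1,1}^{2}\\ &\quad -2f_{0,2}g_{3,1}-4f_{0,2}f_{2,0}g_{2,1}+24f_{0,2}g_{0,2}g_{1,1}g_{2,0}-5f_{1,1}g_{2,2}\bigr)\alpha^{10}\\ &+\bigl(-10f_{1,1}f_{2,0}f_{2,1}+21f_{1,1}g_{0,2}g_{1,1}^{2}-11f_{1,1}f_{3,0}g_{0,2}+14f_{0,2}f_{3,0}g_{1,1}+53f_{1,1}^{2}f_{2,0}g_{1,1}+16f_{1,2}f_{2,0}g_{1,1}+5f_{1,1}f_{2,1}g_{1,1}\\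 &\quad -8f_{1,2}g_{2,1}+11f_{1,2}f_{3,0}+4f_{0,2}f_{2,0}^{3}-8f_{1,2}f_{2,0}^{2}+53f_{1,1}^{3}g_{2,0}-9f_{1,2}g_{1,1}^{2}-29f_{1,1}^{2}g_{1,1}^{2}\\ &\quad +2f_{1,1}^{2}f_{3,0}-6f_{0,3}g_{3,0}-130f_{0,2}f_{1,1}g_{1,1}g_{2,0}+6f_{2,0}f_{2,2}+f_{1,1}^{2}g_{2,1}-16f_{0,2}f_{2,0}f_{3,0}-24f_{0,2}f_{2,0}g_{0,2}g_{2,0}\\ &\quad +2f_{3,1}g_{0,2}+6f_{0,2}g_{0,2}g_{3,0}+4f_{1,1}g_{0,2}^{2}g_{2,0}+98f_{0,2}f_{1,1}f_{2,0}g_{2,0}-56f_{1,1}f_{2,0}g_{0,2}g_{1,1}-10f_{2,0}f_{2,1}g_{0,2}-3f_{0,2}f_{1,1}g_{3,0}\\ &\quad +4f_{1,2}g_{0,2}g_{2,0}-10f_{2,2}g_{1,1}+4f_{0,2}g_{1,2}g_{2,0}+28f_{0,2}g_{1,1}^{3}-4f_{0,2}g_{1,1}g_{2,1}-8f_{0,2}^{2}g_{2,0}^{2}+3f_{0,3}g_{1,1}g_{2,0}\\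 &\quad +14f_{1,1}f_{2,0}^{2}g_{0,2}+3f_{1,1}g_{0,2}g_{2,1}-3f_{1,1}g_{1,1}g_{1,2}+28f_{0,2}f_{2,0}^{2}g_{1,1}-4f_{1,1}^{2}f_{2,0}^{2}-38f_{1,1}^{2}g_{0,2}g_{2,0}+13f_{1,1}f_{3,1}\\ &\quad +5f_{1,1}f_{2,0}g_{1,2}-6f_{1,3}g_{2,0}-f_{1,1}f_{1,2}g_{2,0}+8f_{0,2}f_{4,0}-56f_{0,2}f_{2,0}g_{1,1}^{2}-4f_{0,2}g_{3,1}+4f_{0,2}f_{2,0}g_{2,1}\\ &\quad +26f_{0,2}g_{0,2}g_{1,1}g_{2,0}-5f_{1,1}g_{2,2}\bigr)\alpha^{9}\\ &+\bigl(-16f_{1,1}f_{2,0}f_{2,1}+17f_{1,1}g_{0,2}g_{1,1}^{2}-10f_{1,1}f_{3,0}g_{0,2}+22f_{0,2}f_{3,0}g_{1,1}+36f_{1,1}^{2}f_{2,0}g_{1,1}+24f_{1,2}f_{2,0}g_{1,1}+15f_{1,1}f_{2,1}g_{1,1}\\ &\quad -2f_{1,2}g_{2,1}+2f_{1,2}f_{3,0}+8f_{0,2}f_{2,0}^{3}-14f_{1,2}f_{2,0}^{2}+45f_{1,1}^{3}g_{2,0}-13f_{1,2}g_{1,1}^{2}-22f_{1,1}^{2}g_{1,1}^{2}\\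 &\quad -17f_{1,1}^{2}f_{3,0}-6f_{0,3}g_{3,0}-103f_{0,2}f_{1,1}g_{1,1}g_{2,0}+14f_{1,1}^{2}g_{2,1}-24f_{0,2}f_{2,0}f_{3,0}-f_{3,1}g_{0,2}-28f_{0,2}f_{2,0}g_{0,2}g_{2,0}\\ &\quad +10f_{0,2}g_{0,2}g_{3,0}+10f_{1,1}g_{0,2}^{2}g_{2,0}+6f_{0,2}f_{2,1}g_{2,0}+58f_{0,2}f_{1,1}f_{2,0}g_{2,0}-41f_{1,1}f_{2,0}g_{0,2}g_{1,1}-4f_{2,0}f_{2,1}g_{0,2}+16f_{0,2}f_{1,1}g_{3,0}\\ &\quad +6f_{1,2}g_{0,2}g_{2,0}-4f_{2,2}g_{1,1}+3f_{3,2}+22f_{0,2}g_{1,1}^{3}-6f_{1,1}g_{0,3}g_{2,0}-10f_{0,2}g_{1,1}g_{2,1}-8f_{0,2}^{2}g_{2,0}^{2}\\ &\quad -9f_{0,3}g_{1,1}g_{2,0}+16f_{1,1}f_{2,0}^{2}g_{0,2}-8f_{1,1}g_{1,1}g_{1,2}-4f_{0,2}f_{2,0}^{2}g_{1,1}+6f_{1,1}^{2}f_{2,0}^{2}-36f_{1,1}^{2}g_{0,2}g_{2,0}+10f_{1,1}f_{3,1}\\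 &\quad +10f_{1,1}f_{2,0}g_{1,2}-6f_{1,3}g_{2,0}+20f_{1,1}f_{1,2}g_{2,0}+18f_{0,3}f_{2,0}g_{2,0}+4f_{0,2}f_{4,0}-26f_{0,2}f_{2,0}g_{1,1}^{2}-4f_{0,2}g_{3,1}\\ &\quad +16f_{0,2}f_{2,0}g_{2,1}+36f_{0,2}g_{0,2}g_{1,1}g_{2,0}-2f_{1,1}g_{2,2}\bigr)\alpha^{8}\\ &+\bigl(-10f_{1,1}f_{2,0}f_{2,1}+8f_{1,1}g_{0,2}g_{1,1}^{2}-3f_{1,1}f_{3,0}g_{0,2}+24f_{0,2}f_{3,0}g_{1,1}+12f_{1,1}^{2}f_{2,0}g_{1,1}+14f_{1,2}f_{2,0}g_{1,1}+16f_{1,1}f_{2,1}g_{1,1}\\ &\quad -2f_{1,2}g_{2,1}-f_{1,2}f_{3,0}+16f_{0,2}f_{2,0}^{3}-2f_{1,2}f_{2,0}^{2}+25f_{1,1}^{3}g_{2,0}-14f_{1,2}g_{1,1}^{2}-13f_{1,1}^{2}g_{1,1}^{2}\\ &\quad -21f_{1,1}^{2}f_{3,0}-6f_{0,3}g_{3,0}-62f_{0,2}f_{1,1}g_{1,1}g_{2,0}-6f_{2,0}f_{2,2}+15f_{1,1}^{2}g_{2,1}-12f_{0,2}f_{2,0}f_{3,0}-28f_{0,2}f_{2,0}g_{0,2}g_{2,0}\\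 &\quad -3f_{3,1}g_{0,2}+6f_{1,1}g_{0,2}^{2}g_{2,0}+6f_{0,2}f_{2,1}g_{2,0}-22f_{1,1}f_{2,0}g_{0,2}g_{1,1}+2f_{2,0}f_{2,1}g_{0,2}+21f_{0,2}f_{1,1}g_{3,0}-4f_{1,2}g_{0,2}g_{2,0}\\ &\quad +2f_{2,2}g_{1,1}-4f_{0,2}g_{1,2}g_{2,0}+3f_{3,2}+10f_{0,2}g_{1,1}^{3}-9f_{1,1}g_{0,3}g_{2,0}-18f_{0,2}g_{1,1}g_{2,1}-8f_{0,2}^{2}g_{2,0}^{2}\\ &\quad -21f_{0,3}g_{1,1}g_{2,0}+12f_{1,1}f_{2,0}^{2}g_{0,2}-5f_{1,1}g_{0,2}g_{2,1}-9f_{1,1}g_{1,1}g_{1,2}-24f_{0,2}f_{2,0}^{2}g_{1,1}+20f_{1,1}^{2}f_{2,0}^{2}-29f_{1,1}^{2}g_{0,2}g_{2,0}\\ &\quad +f_{1,1}f_{3,1}+9f_{1,1}f_{2,0}g_{1,2}-3f_{1,3}g_{2,0}+26f_{1,1}f_{1,2}g_{2,0}+18f_{0,3}f_{2,0}g_{2,0}-4f_{0,2}f_{4,0}-4f_{0,2}f_{2,0}g_{1,1}^{2}\\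 &\quad -2f_{0,2}g_{3,1}+12f_{0,2}f_{2,0}g_{2,1}+22f_{0,2}g_{0,2}g_{1,1}g_{2,0}+f_{1,1}g_{2,2}\bigr)\alpha^{7}\\ &+\bigl(2f_{1,1}f_{2,0}f_{2,1}+3f_{1,1}g_{0,2}g_{1,1}^{2}+f_{1,1}f_{3,0}g_{0,2}+12f_{0,2}f_{3,0}g_{1,1}-f_{1,1}^{2}f_{2,0}g_{1,1}+4f_{1,2}f_{2,0}g_{1,1}+11f_{1,1}f_{2,1}g_{1,1}\\ &\quad +4f_{1,2}g_{2,1}-7f_{1,2}f_{3,0}+8f_{0,2}f_{2,0}^{3}+4f_{1,2}f_{2,0}^{2}+8f_{1,1}^{3}g_{2,0}-7f_{1,2}g_{1,1}^{2}-3f_{1,1}^{2}g_{1,1}^{2}\\ &\quad -16f_{1,1}^{2}f_{3,0}+3f_{0,3}g_{3,0}-14f_{0,2}f_{1,1}g_{1,1}g_{2,0}-6f_{2,0}f_{2,2}+13f_{1,1}^{2}g_{2,1}+4f_{0,2}f_{2,0}f_{3,0}-2f_{3,1}g_{0,2}\\ &\quad -2f_{0,2}g_{0,2}g_{3,0}+4f_{1,1}g_{0,2}^{2}g_{2,0}+6f_{0,2}f_{2,1}g_{2,0}-22f_{0,2}f_{1,1}f_{2,0}g_{2,0}+6f_{2,0}f_{2,1}g_{0,2}+20f_{0,2}f_{1,1}g_{3,0}-2f_{1,2}g_{0,2}g_{2,0}\\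 &\quad +6f_{2,2}g_{1,1}+2f_{3,2}+4f_{0,2}g_{1,1}^{3}-6f_{1,1}g_{0,3}g_{2,0}-10f_{0,2}g_{1,1}g_{2,1}-15f_{0,3}g_{1,1}g_{2,0}+2f_{1,1}f_{2,0}^{2}g_{0,2}\\ &\quad -4f_{1,1}f_{2,0}g_{0,2}g_{1,1}-4f_{0,2}g_{1,2}g_{2,0}-3f_{1,1}g_{0,2}g_{2,1}-5f_{1,1}g_{1,1}g_{1,2}-28f_{0,2}f_{2,0}^{2}g_{1,1}+16f_{1,1}^{2}f_{2,0}^{2}-10f_{1,1}^{2}g_{0,2}g_{2,0}\\ &\quad -5f_{1,1}f_{3,1}+5f_{1,1}f_{2,0}g_{1,2}+3f_{1,3}g_{2,0}+23f_{1,1}f_{1,2}g_{2,0}+12f_{0,3}f_{2,0}g_{2,0}-4f_{0,2}f_{4,0}+14f_{0,2}f_{2,0}g_{1,1}^{2}\\ &\quad +2f_{0,2}g_{3,1}+8f_{0,2}f_{2,0}g_{2,1}+3f_{1,1}g_{2,2}+16f_{0,2}g_{0,2}g_{1,1}g_{2,0}\bigr)\alpha^{6}\\ &+\bigl(8f_{1,1}f_{2,0}f_{2,1}+2f_{1,1}f_{3,0}g_{0,2}+2f_{0,2}f_{3,0}g_{1,1}-6f_{1,1}^{2}f_{2,0}g_{1,1}-8f_{1,2}f_{2,0}g_{1,1}+3f_{1,1}f_{2,1}g_{1,1}+2f_{1,2}g_{2,1}\\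 &\quad -4f_{1,2}f_{3,0}+10f_{1,2}f_{2,0}^{2}-3f_{1,1}^{3}g_{2,0}-3f_{1,2}g_{1,1}^{2}-5f_{1,1}^{2}f_{3,0}+3f_{0,3}g_{3,0}-4f_{2,0}f_{2,2}\\ &\quad +4f_{1,1}^{2}g_{2,1}+8f_{0,2}f_{2,0}f_{3,0}-f_{3,1}g_{0,2}+4f_{0,2}f_{2,0}g_{0,2}g_{2,0}-4f_{0,2}g_{0,2}g_{3,0}-30f_{0,2}f_{1,1}f_{2,0}g_{2,0}+f_{1,1}f_{2,0}g_{0,2}g_{1,1}\\ &\quad +4f_{2,0}f_{2,1}g_{0,2}+6f_{0,2}f_{1,1}g_{3,0}-4f_{1,2}g_{0,2}g_{2,0}+4f_{2,2}g_{1,1}-4f_{0,2}g_{1,2}g_{2,0}-f_{3,2}-3f_{1,1}g_{0,3}g_{2,0}\\ &\quad -6f_{0,2}g_{1,1}g_{2,1}-9f_{0,3}g_{1,1}g_{2,0}-4f_{1,1}f_{2,0}^{2}g_{0,2}-2f_{1,1}g_{0,2}g_{2,1}-2f_{1,1}g_{1,1}g_{1,2}+6f_{1,1}^{2}f_{2,0}^{2}-16f_{0,2}f_{2,0}^{2}g_{1,1}\\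 &\quad -3f_{1,1}^{2}g_{0,2}g_{2,0}-8f_{1,1}f_{3,1}+3f_{1,3}g_{2,0}+7f_{1,1}f_{1,2}g_{2,0}-6f_{0,3}f_{2,0}g_{2,0}-4f_{0,2}f_{4,0}+10f_{0,2}f_{2,0}g_{1,1}^{2}\\ &\quad +2f_{0,2}g_{3,1}-4f_{0,2}f_{2,0}g_{2,1}+2f_{1,1}g_{2,2}\bigr)\alpha^{5}\\ &+\bigl(10f_{1,1}f_{2,0}f_{2,1}+f_{1,1}f_{3,0}g_{0,2}-2f_{0,2}f_{3,0}g_{1,1}-6f_{1,2}f_{2,0}g_{1,1}+2f_{1,2}g_{2,1}-f_{1,2}f_{3,0}-4f_{0,2}f_{2,0}^{3}\\ &\quad +6f_{1,2}f_{2,0}^{2}-2f_{1,1}^{3}g_{2,0}+f_{1,1}^{2}g_{1,1}^{2}+3f_{1,1}^{2}f_{3,0}+3f_{0,3}g_{3,0}+6f_{0,2}f_{1,1}g_{1,1}g_{2,0}+2f_{2,0}f_{2,2}\\ &\quad +f_{1,1}^{2}g_{2,1}+8f_{0,2}f_{2,0}f_{3,0}+8f_{0,2}f_{2,0}g_{0,2}g_{2,0}-4f_{0,2}f_{1,1}f_{2,0}g_{2,0}+2f_{1,1}f_{2,0}g_{0,2}g_{1,1}+2f_{2,0}f_{2,1}g_{0,2}+2f_{0,2}f_{1,1}g_{3,0}\\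 &\quad +2f_{2,2}g_{1,1}-f_{3,2}-4f_{1,1}f_{2,0}^{2}g_{0,2}-4f_{1,1}^{2}f_{2,0}^{2}+2f_{1,1}^{2}g_{0,2}g_{2,0}-3f_{1,1}f_{3,1}-f_{1,1}f_{2,0}g_{1,2}\\ &\quad +3f_{1,3}g_{2,0}+f_{1,1}f_{1,2}g_{2,0}-6f_{0,3}f_{2,0}g_{2,0}+6f_{0,2}f_{2,0}g_{1,1}^{2}+2f_{0,2}g_{3,1}-4f_{0,2}f_{2,0}g_{2,1}+f_{1,1}g_{2,2}\bigr)\alpha^{4}\\ &+\bigl(-f_{1,1}^{3}g_{2,0}+4f_{0,2}f_{2,0}^{2}g_{1,1}-f_{1,1}f_{2,0}g_{1,2}-8f_{1,1}^{2}f_{2,0}^{2}-2f_{1,1}f_{2,0}^{2}g_{0,2}-2f_{0,2}f_{1,1}g_{3,0}+f_{1,2}f_{3,0}\\ &\quad -4f_{1,2}f_{2,0}g_{1,1}+2f_{2,0}f_{2,2}-f_{1,1}f_{2,1}g_{1,1}+2f_{1,1}^{2}f_{3,0}+f_{1,1}^{2}f_{2,0}g_{1,1}-f_{3,2}-f_{1,1}^{2}g_{2,1}\\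 &\quad -6f_{0,3}f_{2,0}g_{2,0}-4f_{0,2}f_{2,0}g_{2,1}-3f_{1,1}f_{1,2}g_{2,0}-2f_{0,2}f_{3,0}g_{1,1}-4f_{0,2}f_{2,0}^{3}-f_{1,1}f_{3,1}+2f_{1,1}f_{2,0}f_{2,1}\bigr)\alpha^{3}\\ &+\bigl(-2f_{1,1}^{2}f_{2,0}^{2}+4f_{0,2}f_{2,0}^{2}g_{1,1}+f_{1,2}f_{3,0}+f_{1,1}^{3}g_{2,0}+f_{1,1}^{2}f_{3,0}+4f_{0,2}f_{1,1}f_{2,0}g_{2,0}+2f_{2,0}f_{2,2}\\ &\quad +f_{1,1}f_{3,1}-2f_{1,2}f_{2,0}^{2}+2f_{1,1}^{2}f_{2,0}g_{1,1}\bigr)\alpha^{2}\\ &+\bigl(-2f_{1,2}f_{2,0}^{2}-2f_{1,1}f_{2,0}f_{2,1}-f_{1,1}^{2}f_{3,0}\bigr)\alpha\\ &+2f_{1,1}^{2}f_{2,0}^{2}. \end{align*} -/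

import Mathlib

open scoped ContDiff Topology

namespace PeriodicMaps

/-- The `n`-th iterate of the partial map `F` with domain `U` is well defined at `x`. -/
def IterateDefined {X : Type*} (U : Set X) (F : X → X) (n : ℕ) (x : X) : Prop :=
  ∀ k < n, F^[k] x ∈ U

/-- The `n`-th iterate of the partial map `F` with domain `U` is the identity at all points where
it is well defined. -/
def IterateIsId {X : Type*} (U : Set X) (F : X → X) (n : ℕ) : Prop :=
  ∀ x, IterateDefined U F n x → F^[n] x = x

/-- The partial map `F` with domain `U` is `p`-periodic: `p` is the smallest positive integer
such that the `p`-th iterate is the identity at all points where it is well defined. -/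
def IsPeriodicOfOrder {X : Type*} (U : Set X) (F : X → X) (p : ℕ) : Prop :=
  IsLeast {n : ℕ | 0 < n ∧ IterateIsId U F n} p

/-- The truncation at total degree `n` of `∑_{i+j≥2} c i j x^i y^j`. -/
noncomputable def higherTerms (c : ℕ → ℕ → ℂ) (n : ℕ) (z : ℂ × ℂ) : ℂ :=
  ∑ m ∈ Finset.Icc 2 n, ∑ ij ∈ Finset.HasAntidiagonal.antidiagonal m, c ij.1 ij.2 * z.1 ^ ij.1 * z.2 ^ ij.2

/-- `(α x + ∑_{i+j≥2} f i j x^i y^j, y / α + ∑_{i+j≥2} g i j x^i y^j)` is the Taylor expansion of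
`F` at the origin (in particular `F 0 = 0`). -/
def HasTaylorExpansion (F : ℂ × ℂ → ℂ × ℂ) (α : ℂ) (f g : ℕ → ℕ → ℂ) : Prop :=
  ∀ n : ℕ, (fun z : ℂ × ℂ =>
      F z - (α * z.1 + higherTerms f n z, 1 / α * z.2 + higherTerms g n z))
    =O[𝓝 0] fun z => ‖z‖ ^ (n + 1)

/-- The first of the two third order periodicity polynomials. -/
def P1 {R : Type*} [CommRing R] (α : R) (f g : ℕ → ℕ → R) : R :=
  (f 2 1 + f 1 1 * g 1 1) * α ^ 4 - f 1 1 * (2 * f 2 0 - g 1 1) * α ^ 3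
    + (2 * g 2 0 * f 0 2 - f 1 1 * f 2 0 + f 1 1 * g 1 1) * α ^ 2
    - (f 2 1 + f 1 1 * f 2 0) * α + f 1 1 * f 2 0

/-- The second of the two third order periodicity polynomials. -/
def P2 {R : Type*} [CommRing R] (α : R) (f g : ℕ → ℕ → R) : R :=
  g 0 2 * g 1 1 * α ^ 4 - (g 1 2 + g 0 2 * g 1 1) * α ^ 3
    + (f 1 1 * g 1 1 + 2 * g 2 0 * f 0 2 - g 0 2 * g 1 1) * α ^ 2
    + g 1 1 * (-2 * g 0 2 + f 1 1) * α + f 1 1 * g 1 1 + g 1 2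

/-- The coefficient of `α ^ 17` in `P3`. -/
def p3Coeff17 {R : Type*} [CommRing R] (f g : ℕ → ℕ → R) : R :=
  f 1 1*g 0 2*g 1 1^2

/-- The coefficient of `α ^ 16` in `P3`. -/
def p3Coeff16 {R : Type*} [CommRing R] (f g : ℕ → ℕ → R) : R :=
  2*f 1 1*g 0 2*g 1 1^2 - f 3 1*g 0 2 - f 1 1*g 1 1*g 1 2 - f 1 1*g 0 2*g 2 1

/-- The coefficient of `α ^ 15` in `P3`. -/
def p3Coeff15 {R : Type*} [CommRing R] (f g : ℕ → ℕ → R) : R :=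
  f 3 2 + 3*f 1 1*g 0 2*g 1 1^2 + 3*f 1 1*f 3 0*g 0 2 - 3*f 1 1*g 0 2*g 2 1
    + 2*f 1 1*f 2 0*g 0 2*g 1 1 + 2*f 1 1^2*g 0 2*g 2 0 - 2*f 3 1*g 0 2
    + 2*f 2 0*f 2 1*g 0 2 + f 1 2*g 1 1^2 + 2*f 2 2*g 1 1 + f 1 1*g 2 2
    + 2*f 0 2*f 1 1*g 1 1*g 2 0 - f 1 1*g 1 1*g 1 2 + f 1 1^2*g 1 1^2

/-- The coefficient of `α ^ 14` in `P3`. -/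
def p3Coeff14 {R : Type*} [CommRing R] (f g : ℕ → ℕ → R) : R :=
  3*f 1 1*g 0 2*g 1 1^2 + 6*f 1 1*f 3 0*g 0 2 - 6*f 0 2*f 3 0*g 1 1
    - 4*f 1 2*f 2 0*g 1 1 - 3*f 1 1*f 2 1*g 1 1 + 2*f 1 2*g 2 1
    - 3*f 1 2*f 3 0 + 5*f 1 2*g 1 1^2 + 2*f 1 1^2*g 1 1^2
    + 2*f 0 2*f 1 1*g 1 1*g 2 0 - 2*f 2 0*f 2 2 - 2*f 1 1^2*g 2 1
    - 3*f 3 1*g 0 2 - 2*f 1 1*g 0 2^2*g 2 0 + 3*f 1 1*f 2 0*g 0 2*g 1 1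
    + 4*f 2 0*f 2 1*g 0 2 - 3*f 0 2*f 1 1*g 3 0 - 2*f 1 2*g 0 2*g 2 0
    + 4*f 2 2*g 1 1 + f 3 2 + 2*f 0 2*g 1 1^3 + 2*f 0 2*g 1 1*g 2 1
    - 4*f 1 1*f 2 0^2*g 0 2 - 4*f 1 1*g 0 2*g 2 1 + 6*f 1 1^2*g 0 2*g 2 0
    - 3*f 1 1*f 3 1 - 2*f 1 1*f 2 0*g 1 2 - 2*f 1 1*f 1 2*g 2 0
    - 4*f 0 2*f 4 0 - 2*f 0 2*f 2 0*g 1 1^2 + 2*f 1 1*g 2 2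

/-- The coefficient of `α ^ 13` in `P3`. -/
def p3Coeff13 {R : Type*} [CommRing R] (f g : ℕ → ℕ → R) : R :=
  4*f 1 1*f 2 0*f 2 1 + 4*f 1 1*g 0 2*g 1 1^2 + 11*f 1 1*f 3 0*g 0 2
    - 12*f 0 2*f 3 0*g 1 1 + 6*f 1 1^2*f 2 0*g 1 1 - 10*f 1 2*f 2 0*g 1 1
    - 8*f 1 1*f 2 1*g 1 1 + 2*f 1 2*g 2 1 - 3*f 1 2*f 3 0 + 4*f 1 2*f 2 0^2
    + 3*f 1 1^3*g 2 0 + 10*f 1 2*g 1 1^2 + f 1 1^2*g 1 1^2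
    + 6*f 1 1^2*f 3 0 - 4*f 0 2*f 1 1*g 1 1*g 2 0 - 2*f 2 0*f 2 2
    - 7*f 1 1^2*g 2 1 + 12*f 0 2*f 2 0*f 3 0 + 4*f 0 2*f 2 0*g 0 2*g 2 0
    - f 3 1*g 0 2 - 2*f 0 2*g 0 2*g 3 0 - 6*f 1 1*g 0 2^2*g 2 0
    + 8*f 0 2*f 1 1*f 2 0*g 2 0 + 6*f 2 0*f 2 1*g 0 2 - 6*f 0 2*f 1 1*g 3 0
    - 4*f 1 2*g 0 2*g 2 0 + 6*f 2 2*g 1 1 + f 3 2 + 6*f 0 2*g 1 1^3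
    + 3*f 1 1*g 0 3*g 2 0 + 6*f 0 2*g 1 1*g 2 1 + 6*f 0 3*g 1 1*g 2 0
    - 8*f 1 1*f 2 0^2*g 0 2 - 3*f 1 1*g 0 2*g 2 1 + 5*f 1 1*g 1 1*g 1 2
    + 8*f 0 2*f 2 0^2*g 1 1 + 11*f 1 1^2*g 0 2*g 2 0 - 5*f 1 1*f 3 1
    - 5*f 1 1*f 2 0*g 1 2 + 3*f 1 3*g 2 0 - 8*f 1 1*f 1 2*g 2 0
    - 4*f 0 2*f 4 0 - 12*f 0 2*f 2 0*g 1 1^2 + 2*f 0 2*g 3 1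
    - 4*f 0 2*f 2 0*g 2 1 + 3*f 1 1*g 2 2

/-- The coefficient of `α ^ 12` in `P3`. -/
def p3Coeff12 {R : Type*} [CommRing R] (f g : ℕ → ℕ → R) : R :=
  6*f 1 1*f 2 0*f 2 1 + 9*f 1 1*g 0 2*g 1 1^2 + 7*f 1 1*f 3 0*g 0 2
    - 24*f 0 2*f 3 0*g 1 1 + 19*f 1 1^2*f 2 0*g 1 1 - 16*f 1 2*f 2 0*g 1 1
    - 15*f 1 1*f 2 1*g 1 1 + 4*f 1 2*g 2 1 - 5*f 1 2*f 3 0 - 8*f 0 2*f 2 0^3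
    + 4*f 1 2*f 2 0^2 + 12*f 1 1^3*g 2 0 + 15*f 1 2*g 1 1^2
    - 5*f 1 1^2*g 1 1^2 + 12*f 1 1^2*f 3 0 + 3*f 0 3*g 3 0
    - 33*f 0 2*f 1 1*g 1 1*g 2 0 - 2*f 2 0*f 2 2 - 13*f 1 1^2*g 2 1
    + 12*f 0 2*f 2 0*f 3 0 + 12*f 0 2*f 2 0*g 0 2*g 2 0 + 2*f 3 1*g 0 2
    - 4*f 0 2*g 0 2*g 3 0 - 8*f 1 1*g 0 2^2*g 2 0 - 6*f 0 2*f 2 1*g 2 0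
    + 26*f 0 2*f 1 1*f 2 0*g 2 0 - 14*f 1 1*f 2 0*g 0 2*g 1 1
    + 2*f 2 0*f 2 1*g 0 2 - 15*f 0 2*f 1 1*g 3 0 - 2*f 1 2*g 0 2*g 2 0
    + 2*f 2 2*g 1 1 - 2*f 3 2 + 16*f 0 2*g 1 1^3 + 6*f 1 1*g 0 3*g 2 0
    + 14*f 0 2*g 1 1*g 2 1 + 12*f 0 3*g 1 1*g 2 0 - 14*f 1 1*f 2 0^2*g 0 2
    + 3*f 1 1*g 0 2*g 2 1 + 9*f 1 1*g 1 1*g 1 2 + 20*f 0 2*f 2 0^2*g 1 1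
    - 6*f 1 1^2*f 2 0^2 + 10*f 1 1^2*g 0 2*g 2 0 - 7*f 1 1*f 3 1
    - 9*f 1 1*f 2 0*g 1 2 + 3*f 1 3*g 2 0 - 19*f 1 1*f 1 2*g 2 0
    - 6*f 0 3*f 2 0*g 2 0 - 4*f 0 2*f 4 0 - 30*f 0 2*f 2 0*g 1 1^2
    + 2*f 0 2*g 3 1 - 8*f 0 2*f 2 0*g 2 1 + 4*f 0 2*g 0 2*g 1 1*g 2 0
    + f 1 1*g 2 2

/-- The coefficient of `α ^ 11` in `P3`. -/
def p3Coeff11 {R : Type*} [CommRing R] (f g : ℕ → ℕ → R) : R :=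
  8*f 1 1*f 2 0*f 2 1 + 15*f 1 1*g 0 2*g 1 1^2 + 2*f 1 1*f 3 0*g 0 2
    - 18*f 0 2*f 3 0*g 1 1 + 40*f 1 1^2*f 2 0*g 1 1 - 12*f 1 2*f 2 0*g 1 1
    - 15*f 1 1*f 2 1*g 1 1 - 2*f 1 2*g 2 1 + 4*f 1 2*f 3 0 - 8*f 0 2*f 2 0^3
    + 6*f 1 2*f 2 0^2 + 29*f 1 1^3*g 2 0 + 11*f 1 2*g 1 1^2
    - 16*f 1 1^2*g 1 1^2 + 21*f 1 1^2*f 3 0 + 3*f 0 3*g 3 0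
    - 74*f 0 2*f 1 1*g 1 1*g 2 0 + 4*f 2 0*f 2 2 - 16*f 1 1^2*g 2 1
    + 16*f 0 2*f 2 0*f 3 0 + 12*f 0 2*f 2 0*g 0 2*g 2 0 + 5*f 3 1*g 0 2
    - 6*f 0 2*g 0 2*g 3 0 - 8*f 1 1*g 0 2^2*g 2 0 - 6*f 0 2*f 2 1*g 2 0
    + 70*f 0 2*f 1 1*f 2 0*g 2 0 - 35*f 1 1*f 2 0*g 0 2*g 1 1
    - 4*f 2 0*f 2 1*g 0 2 - 19*f 0 2*f 1 1*g 3 0 - 4*f 2 2*g 1 1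
    + 4*f 0 2*g 1 2*g 2 0 - 3*f 3 2 + 24*f 0 2*g 1 1^3 + 9*f 1 1*g 0 3*g 2 0
    + 14*f 0 2*g 1 1*g 2 1 + 18*f 0 3*g 1 1*g 2 0 - 8*f 1 1*f 2 0^2*g 0 2
    + 6*f 1 1*g 0 2*g 2 1 + 10*f 1 1*g 1 1*g 1 2 + 40*f 0 2*f 2 0^2*g 1 1
    - 10*f 1 1^2*f 2 0^2 - 3*f 1 1^2*g 0 2*g 2 0 - 8*f 1 1*f 2 0*g 1 2
    + 3*f 1 3*g 2 0 - 25*f 1 1*f 1 2*g 2 0 - 12*f 0 3*f 2 0*g 2 0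
    + 4*f 0 2*f 4 0 - 54*f 0 2*f 2 0*g 1 1^2 + 2*f 0 2*g 3 1
    - 12*f 0 2*f 2 0*g 2 1 + 10*f 0 2*g 0 2*g 1 1*g 2 0 - 2*f 1 1*g 2 2

/-- The coefficient of `α ^ 10` in `P3`. -/
def p3Coeff10 {R : Type*} [CommRing R] (f g : ℕ → ℕ → R) : R :=
  -2*f 1 1*f 2 0*f 2 1 + 22*f 1 1*g 0 2*g 1 1^2 - 9*f 1 1*f 3 0*g 0 2
    - 10*f 0 2*f 3 0*g 1 1 + 54*f 1 1^2*f 2 0*g 1 1 + 2*f 1 2*f 2 0*g 1 1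
    - 8*f 1 1*f 2 1*g 1 1 - 2*f 1 2*g 2 1 + 5*f 1 2*f 3 0 - 12*f 0 2*f 2 0^3
    - 6*f 1 2*f 2 0^2 + 46*f 1 1^3*g 2 0 + 4*f 1 2*g 1 1^2
    - 25*f 1 1^2*g 1 1^2 + 13*f 1 1^2*f 3 0 + 3*f 0 3*g 3 0
    - 115*f 0 2*f 1 1*g 1 1*g 2 0 + 6*f 2 0*f 2 2 - 9*f 1 1^2*g 2 1
    - 8*f 0 2*f 2 0*f 3 0 + 4*f 0 2*f 2 0*g 0 2*g 2 0 + 5*f 3 1*g 0 2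
    + 2*f 0 2*g 0 2*g 3 0 - 6*f 0 2*f 2 1*g 2 0 + 98*f 0 2*f 1 1*f 2 0*g 2 0
    - 52*f 1 1*f 2 0*g 0 2*g 1 1 - 10*f 2 0*f 2 1*g 0 2
    - 17*f 0 2*f 1 1*g 3 0 + 8*f 1 2*g 0 2*g 2 0 - 10*f 2 2*g 1 1
    + 4*f 0 2*g 1 2*g 2 0 - 3*f 3 2 + 32*f 0 2*g 1 1^3 + 6*f 1 1*g 0 3*g 2 0
    + 12*f 0 2*g 1 1*g 2 1 - 8*f 0 2^2*g 2 0^2 + 15*f 0 3*g 1 1*g 2 0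
    + 9*f 1 1*g 0 2*g 2 1 + 5*f 1 1*g 1 1*g 1 2 + 40*f 0 2*f 2 0^2*g 1 1
    - 16*f 1 1^2*f 2 0^2 - 20*f 1 1^2*g 0 2*g 2 0 + 7*f 1 1*f 3 1
    - 3*f 1 1*f 2 0*g 1 2 - 3*f 1 3*g 2 0 - 19*f 1 1*f 1 2*g 2 0
    - 12*f 0 3*f 2 0*g 2 0 + 8*f 0 2*f 4 0 - 62*f 0 2*f 2 0*g 1 1^2
    - 2*f 0 2*g 3 1 - 4*f 0 2*f 2 0*g 2 1 + 24*f 0 2*g 0 2*g 1 1*g 2 0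
    - 5*f 1 1*g 2 2

/-- The coefficient of `α ^ 9` in `P3`. -/
def p3Coeff9 {R : Type*} [CommRing R] (f g : ℕ → ℕ → R) : R :=
  -10*f 1 1*f 2 0*f 2 1 + 21*f 1 1*g 0 2*g 1 1^2 - 11*f 1 1*f 3 0*g 0 2
    + 14*f 0 2*f 3 0*g 1 1 + 53*f 1 1^2*f 2 0*g 1 1 + 16*f 1 2*f 2 0*g 1 1
    + 5*f 1 1*f 2 1*g 1 1 - 8*f 1 2*g 2 1 + 11*f 1 2*f 3 0 + 4*f 0 2*f 2 0^3
    - 8*f 1 2*f 2 0^2 + 53*f 1 1^3*g 2 0 - 9*f 1 2*g 1 1^2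
    - 29*f 1 1^2*g 1 1^2 + 2*f 1 1^2*f 3 0 - 6*f 0 3*g 3 0
    - 130*f 0 2*f 1 1*g 1 1*g 2 0 + 6*f 2 0*f 2 2 + f 1 1^2*g 2 1
    - 16*f 0 2*f 2 0*f 3 0 - 24*f 0 2*f 2 0*g 0 2*g 2 0 + 2*f 3 1*g 0 2
    + 6*f 0 2*g 0 2*g 3 0 + 4*f 1 1*g 0 2^2*g 2 0
    + 98*f 0 2*f 1 1*f 2 0*g 2 0 - 56*f 1 1*f 2 0*g 0 2*g 1 1
    - 10*f 2 0*f 2 1*g 0 2 - 3*f 0 2*f 1 1*g 3 0 + 4*f 1 2*g 0 2*g 2 0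
    - 10*f 2 2*g 1 1 + 4*f 0 2*g 1 2*g 2 0 + 28*f 0 2*g 1 1^3
    - 4*f 0 2*g 1 1*g 2 1 - 8*f 0 2^2*g 2 0^2 + 3*f 0 3*g 1 1*g 2 0
    + 14*f 1 1*f 2 0^2*g 0 2 + 3*f 1 1*g 0 2*g 2 1 - 3*f 1 1*g 1 1*g 1 2
    + 28*f 0 2*f 2 0^2*g 1 1 - 4*f 1 1^2*f 2 0^2 - 38*f 1 1^2*g 0 2*g 2 0
    + 13*f 1 1*f 3 1 + 5*f 1 1*f 2 0*g 1 2 - 6*f 1 3*g 2 0 - f 1 1*f 1 2*g 2 0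
    + 8*f 0 2*f 4 0 - 56*f 0 2*f 2 0*g 1 1^2 - 4*f 0 2*g 3 1
    + 4*f 0 2*f 2 0*g 2 1 + 26*f 0 2*g 0 2*g 1 1*g 2 0 - 5*f 1 1*g 2 2

/-- The coefficient of `α ^ 8` in `P3`. -/
def p3Coeff8 {R : Type*} [CommRing R] (f g : ℕ → ℕ → R) : R :=
  -16*f 1 1*f 2 0*f 2 1 + 17*f 1 1*g 0 2*g 1 1^2 - 10*f 1 1*f 3 0*g 0 2
    + 22*f 0 2*f 3 0*g 1 1 + 36*f 1 1^2*f 2 0*g 1 1 + 24*f 1 2*f 2 0*g 1 1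
    + 15*f 1 1*f 2 1*g 1 1 - 2*f 1 2*g 2 1 + 2*f 1 2*f 3 0 + 8*f 0 2*f 2 0^3
    - 14*f 1 2*f 2 0^2 + 45*f 1 1^3*g 2 0 - 13*f 1 2*g 1 1^2
    - 22*f 1 1^2*g 1 1^2 - 17*f 1 1^2*f 3 0 - 6*f 0 3*g 3 0
    - 103*f 0 2*f 1 1*g 1 1*g 2 0 + 14*f 1 1^2*g 2 1 - 24*f 0 2*f 2 0*f 3 0
    - f 3 1*g 0 2 - 28*f 0 2*f 2 0*g 0 2*g 2 0 + 10*f 0 2*g 0 2*g 3 0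
    + 10*f 1 1*g 0 2^2*g 2 0 + 6*f 0 2*f 2 1*g 2 0
    + 58*f 0 2*f 1 1*f 2 0*g 2 0 - 41*f 1 1*f 2 0*g 0 2*g 1 1
    - 4*f 2 0*f 2 1*g 0 2 + 16*f 0 2*f 1 1*g 3 0 + 6*f 1 2*g 0 2*g 2 0
    - 4*f 2 2*g 1 1 + 3*f 3 2 + 22*f 0 2*g 1 1^3 - 6*f 1 1*g 0 3*g 2 0
    - 10*f 0 2*g 1 1*g 2 1 - 8*f 0 2^2*g 2 0^2 - 9*f 0 3*g 1 1*g 2 0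
    + 16*f 1 1*f 2 0^2*g 0 2 - 8*f 1 1*g 1 1*g 1 2 - 4*f 0 2*f 2 0^2*g 1 1
    + 6*f 1 1^2*f 2 0^2 - 36*f 1 1^2*g 0 2*g 2 0 + 10*f 1 1*f 3 1
    + 10*f 1 1*f 2 0*g 1 2 - 6*f 1 3*g 2 0 + 20*f 1 1*f 1 2*g 2 0
    + 18*f 0 3*f 2 0*g 2 0 + 4*f 0 2*f 4 0 - 26*f 0 2*f 2 0*g 1 1^2
    - 4*f 0 2*g 3 1 + 16*f 0 2*f 2 0*g 2 1 + 36*f 0 2*g 0 2*g 1 1*g 2 0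
    - 2*f 1 1*g 2 2

/-- The coefficient of `α ^ 7` in `P3`. -/
def p3Coeff7 {R : Type*} [CommRing R] (f g : ℕ → ℕ → R) : R :=
  -10*f 1 1*f 2 0*f 2 1 + 8*f 1 1*g 0 2*g 1 1^2 - 3*f 1 1*f 3 0*g 0 2
    + 24*f 0 2*f 3 0*g 1 1 + 12*f 1 1^2*f 2 0*g 1 1 + 14*f 1 2*f 2 0*g 1 1
    + 16*f 1 1*f 2 1*g 1 1 - 2*f 1 2*g 2 1 - f 1 2*f 3 0 + 16*f 0 2*f 2 0^3
    - 2*f 1 2*f 2 0^2 + 25*f 1 1^3*g 2 0 - 14*f 1 2*g 1 1^2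
    - 13*f 1 1^2*g 1 1^2 - 21*f 1 1^2*f 3 0 - 6*f 0 3*g 3 0
    - 62*f 0 2*f 1 1*g 1 1*g 2 0 - 6*f 2 0*f 2 2 + 15*f 1 1^2*g 2 1
    - 12*f 0 2*f 2 0*f 3 0 - 28*f 0 2*f 2 0*g 0 2*g 2 0 - 3*f 3 1*g 0 2
    + 6*f 1 1*g 0 2^2*g 2 0 + 6*f 0 2*f 2 1*g 2 0
    - 22*f 1 1*f 2 0*g 0 2*g 1 1 + 2*f 2 0*f 2 1*g 0 2 + 21*f 0 2*f 1 1*g 3 0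
    - 4*f 1 2*g 0 2*g 2 0 + 2*f 2 2*g 1 1 - 4*f 0 2*g 1 2*g 2 0 + 3*f 3 2
    + 10*f 0 2*g 1 1^3 - 9*f 1 1*g 0 3*g 2 0 - 18*f 0 2*g 1 1*g 2 1
    - 8*f 0 2^2*g 2 0^2 - 21*f 0 3*g 1 1*g 2 0 + 12*f 1 1*f 2 0^2*g 0 2
    - 5*f 1 1*g 0 2*g 2 1 - 9*f 1 1*g 1 1*g 1 2 - 24*f 0 2*f 2 0^2*g 1 1
    + 20*f 1 1^2*f 2 0^2 - 29*f 1 1^2*g 0 2*g 2 0 + f 1 1*f 3 1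
    + 9*f 1 1*f 2 0*g 1 2 - 3*f 1 3*g 2 0 + 26*f 1 1*f 1 2*g 2 0
    + 18*f 0 3*f 2 0*g 2 0 - 4*f 0 2*f 4 0 - 4*f 0 2*f 2 0*g 1 1^2
    - 2*f 0 2*g 3 1 + 12*f 0 2*f 2 0*g 2 1 + 22*f 0 2*g 0 2*g 1 1*g 2 0
    + f 1 1*g 2 2

/-- The coefficient of `α ^ 6` in `P3`. -/
def p3Coeff6 {R : Type*} [CommRing R] (f g : ℕ → ℕ → R) : R :=
  2*f 1 1*f 2 0*f 2 1 + 3*f 1 1*g 0 2*g 1 1^2 + f 1 1*f 3 0*g 0 2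
    + 12*f 0 2*f 3 0*g 1 1 - f 1 1^2*f 2 0*g 1 1 + 4*f 1 2*f 2 0*g 1 1
    + 11*f 1 1*f 2 1*g 1 1 + 4*f 1 2*g 2 1 - 7*f 1 2*f 3 0 + 8*f 0 2*f 2 0^3
    + 4*f 1 2*f 2 0^2 + 8*f 1 1^3*g 2 0 - 7*f 1 2*g 1 1^2
    - 3*f 1 1^2*g 1 1^2 - 16*f 1 1^2*f 3 0 + 3*f 0 3*g 3 0
    - 14*f 0 2*f 1 1*g 1 1*g 2 0 - 6*f 2 0*f 2 2 + 13*f 1 1^2*g 2 1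
    + 4*f 0 2*f 2 0*f 3 0 - 2*f 3 1*g 0 2 - 2*f 0 2*g 0 2*g 3 0
    + 4*f 1 1*g 0 2^2*g 2 0 + 6*f 0 2*f 2 1*g 2 0
    - 22*f 0 2*f 1 1*f 2 0*g 2 0 + 6*f 2 0*f 2 1*g 0 2 + 20*f 0 2*f 1 1*g 3 0
    - 2*f 1 2*g 0 2*g 2 0 + 6*f 2 2*g 1 1 + 2*f 3 2 + 4*f 0 2*g 1 1^3
    - 6*f 1 1*g 0 3*g 2 0 - 10*f 0 2*g 1 1*g 2 1 - 15*f 0 3*g 1 1*g 2 0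
    + 2*f 1 1*f 2 0^2*g 0 2 - 4*f 1 1*f 2 0*g 0 2*g 1 1
    - 4*f 0 2*g 1 2*g 2 0 - 3*f 1 1*g 0 2*g 2 1 - 5*f 1 1*g 1 1*g 1 2
    - 28*f 0 2*f 2 0^2*g 1 1 + 16*f 1 1^2*f 2 0^2
    - 10*f 1 1^2*g 0 2*g 2 0 - 5*f 1 1*f 3 1 + 5*f 1 1*f 2 0*g 1 2
    + 3*f 1 3*g 2 0 + 23*f 1 1*f 1 2*g 2 0 + 12*f 0 3*f 2 0*g 2 0
    - 4*f 0 2*f 4 0 + 14*f 0 2*f 2 0*g 1 1^2 + 2*f 0 2*g 3 1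
    + 8*f 0 2*f 2 0*g 2 1 + 3*f 1 1*g 2 2 + 16*f 0 2*g 0 2*g 1 1*g 2 0

/-- The coefficient of `α ^ 5` in `P3`. -/
def p3Coeff5 {R : Type*} [CommRing R] (f g : ℕ → ℕ → R) : R :=
  8*f 1 1*f 2 0*f 2 1 + 2*f 1 1*f 3 0*g 0 2 + 2*f 0 2*f 3 0*g 1 1
    - 6*f 1 1^2*f 2 0*g 1 1 - 8*f 1 2*f 2 0*g 1 1 + 3*f 1 1*f 2 1*g 1 1
    + 2*f 1 2*g 2 1 - 4*f 1 2*f 3 0 + 10*f 1 2*f 2 0^2 - 3*f 1 1^3*g 2 0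
    - 3*f 1 2*g 1 1^2 - 5*f 1 1^2*f 3 0 + 3*f 0 3*g 3 0 - 4*f 2 0*f 2 2
    + 4*f 1 1^2*g 2 1 + 8*f 0 2*f 2 0*f 3 0 - f 3 1*g 0 2
    + 4*f 0 2*f 2 0*g 0 2*g 2 0 - 4*f 0 2*g 0 2*g 3 0
    - 30*f 0 2*f 1 1*f 2 0*g 2 0 + f 1 1*f 2 0*g 0 2*g 1 1
    + 4*f 2 0*f 2 1*g 0 2 + 6*f 0 2*f 1 1*g 3 0 - 4*f 1 2*g 0 2*g 2 0
    + 4*f 2 2*g 1 1 - 4*f 0 2*g 1 2*g 2 0 - f 3 2 - 3*f 1 1*g 0 3*g 2 0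
    - 6*f 0 2*g 1 1*g 2 1 - 9*f 0 3*g 1 1*g 2 0 - 4*f 1 1*f 2 0^2*g 0 2
    - 2*f 1 1*g 0 2*g 2 1 - 2*f 1 1*g 1 1*g 1 2 + 6*f 1 1^2*f 2 0^2
    - 16*f 0 2*f 2 0^2*g 1 1 - 3*f 1 1^2*g 0 2*g 2 0 - 8*f 1 1*f 3 1
    + 3*f 1 3*g 2 0 + 7*f 1 1*f 1 2*g 2 0 - 6*f 0 3*f 2 0*g 2 0
    - 4*f 0 2*f 4 0 + 10*f 0 2*f 2 0*g 1 1^2 + 2*f 0 2*g 3 1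
    - 4*f 0 2*f 2 0*g 2 1 + 2*f 1 1*g 2 2

/-- The coefficient of `α ^ 4` in `P3`. -/
def p3Coeff4 {R : Type*} [CommRing R] (f g : ℕ → ℕ → R) : R :=
  10*f 1 1*f 2 0*f 2 1 + f 1 1*f 3 0*g 0 2 - 2*f 0 2*f 3 0*g 1 1
    - 6*f 1 2*f 2 0*g 1 1 + 2*f 1 2*g 2 1 - f 1 2*f 3 0 - 4*f 0 2*f 2 0^3
    + 6*f 1 2*f 2 0^2 - 2*f 1 1^3*g 2 0 + f 1 1^2*g 1 1^2
    + 3*f 1 1^2*f 3 0 + 3*f 0 3*g 3 0 + 6*f 0 2*f 1 1*g 1 1*g 2 0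
    + 2*f 2 0*f 2 2 + f 1 1^2*g 2 1 + 8*f 0 2*f 2 0*f 3 0
    + 8*f 0 2*f 2 0*g 0 2*g 2 0 - 4*f 0 2*f 1 1*f 2 0*g 2 0
    + 2*f 1 1*f 2 0*g 0 2*g 1 1 + 2*f 2 0*f 2 1*g 0 2 + 2*f 0 2*f 1 1*g 3 0
    + 2*f 2 2*g 1 1 - f 3 2 - 4*f 1 1*f 2 0^2*g 0 2 - 4*f 1 1^2*f 2 0^2
    + 2*f 1 1^2*g 0 2*g 2 0 - 3*f 1 1*f 3 1 - f 1 1*f 2 0*g 1 2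
    + 3*f 1 3*g 2 0 + f 1 1*f 1 2*g 2 0 - 6*f 0 3*f 2 0*g 2 0
    + 6*f 0 2*f 2 0*g 1 1^2 + 2*f 0 2*g 3 1 - 4*f 0 2*f 2 0*g 2 1
    + f 1 1*g 2 2

/-- The coefficient of `α ^ 3` in `P3`. -/
def p3Coeff3 {R : Type*} [CommRing R] (f g : ℕ → ℕ → R) : R :=
  -f 1 1^3*g 2 0 + 4*f 0 2*f 2 0^2*g 1 1 - f 1 1*f 2 0*g 1 2
    - 8*f 1 1^2*f 2 0^2 - 2*f 1 1*f 2 0^2*g 0 2 - 2*f 0 2*f 1 1*g 3 0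
    + f 1 2*f 3 0 - 4*f 1 2*f 2 0*g 1 1 + 2*f 2 0*f 2 2 - f 1 1*f 2 1*g 1 1
    + 2*f 1 1^2*f 3 0 + f 1 1^2*f 2 0*g 1 1 - f 3 2 - f 1 1^2*g 2 1
    - 6*f 0 3*f 2 0*g 2 0 - 4*f 0 2*f 2 0*g 2 1 - 3*f 1 1*f 1 2*g 2 0
    - 2*f 0 2*f 3 0*g 1 1 - 4*f 0 2*f 2 0^3 - f 1 1*f 3 1
    + 2*f 1 1*f 2 0*f 2 1

/-- The coefficient of `α ^ 2` in `P3`. -/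
def p3Coeff2 {R : Type*} [CommRing R] (f g : ℕ → ℕ → R) : R :=
  -2*f 1 1^2*f 2 0^2 + 4*f 0 2*f 2 0^2*g 1 1 + f 1 2*f 3 0 + f 1 1^3*g 2 0
    + f 1 1^2*f 3 0 + 4*f 0 2*f 1 1*f 2 0*g 2 0 + 2*f 2 0*f 2 2 + f 1 1*f 3 1
    - 2*f 1 2*f 2 0^2 + 2*f 1 1^2*f 2 0*g 1 1

/-- The coefficient of `α` in `P3`. -/
def p3Coeff1 {R : Type*} [CommRing R] (f _g : ℕ → ℕ → R) : R :=
  -2*f 1 2*f 2 0^2 - 2*f 1 1*f 2 0*f 2 1 - f 1 1^2*f 3 0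

/-- The constant term in `α` of `P3`. -/
def p3Coeff0 {R : Type*} [CommRing R] (f _g : ℕ → ℕ → R) : R :=
  2*f 1 1^2*f 2 0^2

/-- The fifth order periodicity polynomial. -/
def P3 {R : Type*} [CommRing R] (α : R) (f g : ℕ → ℕ → R) : R :=
  p3Coeff17 f g * α ^ 17 + p3Coeff16 f g * α ^ 16 + p3Coeff15 f g * α ^ 15
    + p3Coeff14 f g * α ^ 14 + p3Coeff13 f g * α ^ 13 + p3Coeff12 f g * α ^ 12
    + p3Coeff11 f g * α ^ 11 + p3Coeff10 f g * α ^ 10 + p3Coeff9 f g * α ^ 9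
    + p3Coeff8 f g * α ^ 8 + p3Coeff7 f g * α ^ 7 + p3Coeff6 f g * α ^ 6
    + p3Coeff5 f g * α ^ 5 + p3Coeff4 f g * α ^ 4 + p3Coeff3 f g * α ^ 3
    + p3Coeff2 f g * α ^ 2 + p3Coeff1 f g * α + p3Coeff0 f g

end PeriodicMaps

/-!
A periodic map is linearizable. If `F ^ p = id` near the origin and `α ^ p = 1`, then the average
`ψ₁ = p⁻¹ ∑_{k<p} α⁻ᵏ x ∘ F ^ k` satisfies `ψ₁ ∘ F = α ψ₁` and has linear part `x`, and similarly
there is `ψ₂` with `ψ₂ ∘ F = α⁻¹ ψ₂` and linear part `y` (`exists_linearizing_jet`). Only the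
`5`-jets of these functions matter, so everything is a relation between the coefficients of
polynomials: `Approx n h p` says that the polynomial `p` is the `n`-jet of `h` up to terms of degree
at least `n`, and such a `p` is unique below degree `n` (`Approx.coeff₂_eq`).

The relation `ψ₁ ∘ F = α ψ₁` can be solved for the coefficients `f i j`: each is a polynomial in
`α`, the coefficients `a i j` of `ψ₁` and the `g i j`, so that no division by a resonance factor
`α ^ m - 1` occurs. Inserting these polynomials, `P1` vanishes identically and `P3` becomes a
multiple of `P2` (`P1_eq_zero_and_P3_eq`). Finally `ψ₂ ∘ F = α⁻¹ ψ₂` forces `P2 = 0`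
(`P2_eq_zero`): just as for `P1` and `x ^ 2 * y`, its resonant monomial `x * y ^ 2` has the same
eigenvalue `α⁻¹` as `y`, so its coefficient in `ψ₂` drops out and leaves a condition on `F`.
-/

namespace PeriodicMaps

open Polynomial Polynomial.Bivariate Filter Asymptotics

/-! ### Coefficients of bivariate polynomials -/

/-- The coefficient of `x ^ i * y ^ j` in a bivariate polynomial; the outer variable is `y`. -/
noncomputable def coeff₂ (p : ℂ[X][Y]) (i j : ℕ) : ℂ := (p.coeff j).coeff i

theorem coeff₂_add (p q : ℂ[X][Y]) (i j : ℕ) :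
    coeff₂ (p + q) i j = coeff₂ p i j + coeff₂ q i j := by
  simp [coeff₂]

theorem coeff₂_sub (p q : ℂ[X][Y]) (i j : ℕ) :
    coeff₂ (p - q) i j = coeff₂ p i j - coeff₂ q i j := by
  simp [coeff₂]

theorem coeff₂_smul (c : ℂ) (p : ℂ[X][Y]) (i j : ℕ) :
    coeff₂ (c • p) i j = c * coeff₂ p i j := by
  simp [coeff₂]

theorem coeff₂_mul (p q : ℂ[X][Y]) (i j : ℕ) : coeff₂ (p * q) i j =
    ∑ s ∈ Finset.range (i + 1), ∑ t ∈ Finset.range (j + 1),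
      coeff₂ p s t * coeff₂ q (i - s) (j - t) := by
  simp only [coeff₂, coeff_mul, finsetSum_coeff,
    Finset.Nat.sum_antidiagonal_eq_sum_range_succ_mk]
  exact Finset.sum_comm

/-- The polynomial `∑_{i+j<n} c i j x^i y^j`, evaluated at elements `x`, `y` of a `ℂ`-algebra. -/
noncomputable def jet {A : Type*} [CommRing A] [Algebra ℂ A] (n : ℕ) (c : ℕ → ℕ → ℂ) (x y : A) :
    A :=
  ∑ m ∈ Finset.range n, ∑ ij ∈ Finset.HasAntidiagonal.antidiagonal m,
    c ij.1 ij.2 • (x ^ ij.1 * y ^ ij.2)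

theorem jet_smul_right {A : Type*} [CommRing A] [Algebra ℂ A] (n : ℕ) (c : ℕ → ℕ → ℂ) (t : ℂ)
    (x y : A) : jet n c x (t • y) = jet n (fun i j => t ^ j * c i j) x y := by
  refine Finset.sum_congr rfl fun m _ => Finset.sum_congr rfl fun ij _ => ?_
  rw [_root_.smul_pow, mul_smul_comm, smul_smul, mul_comm]

theorem evalEval_jet (n : ℕ) (c : ℕ → ℕ → ℂ) (P Q : ℂ[X][Y]) (x y : ℂ) :
    (jet n c P Q).evalEval x y = jet n c (P.evalEval x y) (Q.evalEval x y) := by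
  simp [jet, evalEval_finsetSum, evalEval_smul, evalEval_mul, evalEval_pow]

theorem coeff₂_monomial (c : ℂ) (k l i j : ℕ) :
    coeff₂ (c • ((C X : ℂ[X][Y]) ^ k * Y ^ l)) i j = if (i, j) = (k, l) then c else 0 := by
  rw [coeff₂_smul, coeff₂, ← C_pow, coeff_C_mul, coeff_X_pow]
  by_cases hj : j = l <;> by_cases hi : i = k <;> simp [hi, hj, coeff_X_pow]

theorem coeff₂_jet (n : ℕ) (c : ℕ → ℕ → ℂ) (i j : ℕ) :
    coeff₂ (jet n c (C X) Y) i j = if i + j < n then c i j else 0 := by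
  have h (m : ℕ) : coeff₂ (∑ ij ∈ Finset.HasAntidiagonal.antidiagonal m,
      c ij.1 ij.2 • ((C X : ℂ[X][Y]) ^ ij.1 * Y ^ ij.2)) i j = if i + j = m then c i j else 0 := by
    rw [coeff₂, finsetSum_coeff, finsetSum_coeff]
    change ∑ ij ∈ Finset.HasAntidiagonal.antidiagonal m,
      coeff₂ (c ij.1 ij.2 • ((C X : ℂ[X][Y]) ^ ij.1 * Y ^ ij.2)) i j = _
    simp only [coeff₂_monomial]
    rw [← Finset.sum_filter, Finset.sum_filter]
    simp [Finset.sum_ite_eq]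
  rw [coeff₂, jet, finsetSum_coeff, finsetSum_coeff]
  change ∑ m ∈ Finset.range n, coeff₂ (∑ ij ∈ Finset.HasAntidiagonal.antidiagonal m,
      c ij.1 ij.2 • ((C X : ℂ[X][Y]) ^ ij.1 * Y ^ ij.2)) i j = _
  simp [h]

/-! ### Polynomial approximation at the origin -/

/-- `h` agrees with the polynomial `p` at the origin up to an error of order `n`. -/
def Approx (n : ℕ) (h : ℂ × ℂ → ℂ) (p : ℂ[X][Y]) : Prop :=
  (fun z => h z - p.evalEval z.1 z.2) =O[𝓝 0] fun z => ‖z‖ ^ n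

theorem norm_pow_isBigO {m n : ℕ} (h : m ≤ n) :
    (fun z : ℂ × ℂ => ‖z‖ ^ n) =O[𝓝 0] fun z => ‖z‖ ^ m := by
  obtain ⟨k, rfl⟩ := Nat.exists_eq_add_of_le h
  have : (fun z : ℂ × ℂ => ‖z‖ ^ k) =O[𝓝 0] fun _ => (1 : ℝ) :=
    ((continuous_norm.pow k).tendsto 0).isBigO_one ℝ
  simpa [pow_add] using (isBigO_refl (fun z : ℂ × ℂ => ‖z‖ ^ m) (𝓝 0)).mul this

theorem evalEval_eq_sum (p : ℂ[X][Y]) (x y : ℂ) : p.evalEval x y =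
    ∑ j ∈ Finset.range (p.natDegree + 1), ∑ i ∈ Finset.range ((p.coeff j).natDegree + 1),
      coeff₂ p i j * x ^ i * y ^ j := by
  rw [evalEval, eval_eq_sum_range (p := p), eval_finsetSum]
  refine Finset.sum_congr rfl fun j _ => ?_
  rw [eval_mul, ← C_pow, eval_C, eval_eq_sum_range, Finset.sum_mul]
  rfl

theorem continuous_evalEval (p : ℂ[X][Y]) : Continuous fun z : ℂ × ℂ => p.evalEval z.1 z.2 := by
  simp only [evalEval_eq_sum]
  fun_prop

theorem evalEval_isBigO_one (p : ℂ[X][Y]) :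
    (fun z : ℂ × ℂ => p.evalEval z.1 z.2) =O[𝓝 0] fun _ => (1 : ℝ) :=
  ((continuous_evalEval p).tendsto 0).isBigO_one ℝ

theorem approx_eval (n : ℕ) (p : ℂ[X][Y]) : Approx n (fun z => p.evalEval z.1 z.2) p := by
  simpa [Approx] using isBigO_zero _ _

namespace Approx

variable {n : ℕ} {h k : ℂ × ℂ → ℂ} {p q : ℂ[X][Y]}

theorem mono {m : ℕ} (hp : Approx n h p) (hm : m ≤ n) : Approx m h p :=
  hp.trans (norm_pow_isBigO hm)

theorem sub (hp : Approx n h p) (hq : Approx n k q) : Approx n (fun z => h z - k z) (p - q) := by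
  refine (IsBigO.sub hp hq).congr_left fun z => ?_
  rw [evalEval_sub]; ring

theorem smul (c : ℂ) (hp : Approx n h p) : Approx n (fun z => c * h z) (c • p) := by
  refine (IsBigO.const_mul_left hp c).congr_left fun z => ?_
  rw [evalEval_smul, smul_eq_mul]; ring

theorem isBigO_one (hp : Approx n h p) : h =O[𝓝 0] fun _ => (1 : ℝ) := by
  have h0 := (IsBigO.trans hp (norm_pow_isBigO n.zero_le)).congr_right fun z => pow_zero ‖z‖
  exact (h0.add (evalEval_isBigO_one p)).congr_left fun z => by ring

theorem mul (hp : Approx n h p) (hq : Approx n k q) : Approx n (fun z => h z * k z) (p * q) := by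
  have h1 := (IsBigO.mul hp hq.isBigO_one).congr_right fun z => mul_one (‖z‖ ^ n)
  have h2 := ((evalEval_isBigO_one p).mul hq).congr_right fun z => one_mul (‖z‖ ^ n)
  refine (h1.add h2).congr_left fun z => ?_
  rw [evalEval_mul]; ring

theorem pow (hp : Approx n h p) (m : ℕ) : Approx n (fun z => h z ^ m) (p ^ m) := by
  induction m with
  | zero => simpa using approx_eval n 1
  | succ m ih => simpa only [pow_succ] using ih.mul hp

theorem sum {ι : Type*} (s : Finset ι) {H : ι → ℂ × ℂ → ℂ} {R : ι → ℂ[X][Y]}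
    (hR : ∀ i ∈ s, Approx n (H i) (R i)) :
    Approx n (fun z => ∑ i ∈ s, H i z) (∑ i ∈ s, R i) := by
  refine (IsBigO.fun_sum hR).congr_left fun z => ?_
  rw [evalEval_finsetSum, Finset.sum_sub_distrib]

theorem jet_apply (hp : Approx n h p) (hq : Approx n k q) (m : ℕ) (c : ℕ → ℕ → ℂ) :
    Approx n (fun z => jet m c (h z) (k z)) (jet m c p q) :=
  sum _ fun _ _ => sum _ fun ij _ => ((hp.pow ij.1).mul (hq.pow ij.2)).smul _

end Approx

theorem pow_mul_pow_isBigO (i j : ℕ) :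
    (fun z : ℂ × ℂ => z.1 ^ i * z.2 ^ j) =O[𝓝 0] fun z => ‖z‖ ^ (i + j) := by
  refine IsBigO.of_bound 1 (Eventually.of_forall fun z => ?_)
  rw [norm_mul, norm_pow, norm_pow, one_mul, norm_pow, norm_norm, pow_add]
  gcongr
  · exact norm_fst_le z
  · exact norm_snd_le z

/-- A polynomial is approximated by its truncation. -/
theorem Approx.truncate {n : ℕ} {h : ℂ × ℂ → ℂ} {p : ℂ[X][Y]} (hp : Approx n h p) :
    Approx n h (jet n (coeff₂ p) (C X) Y) := by
  set q : ℂ[X][Y] := p - jet n (coeff₂ p) (C X) (Y : ℂ[X][Y]) with hq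
  have hq0 (i j : ℕ) (hij : i + j < n) : coeff₂ q i j = 0 := by
    rw [hq, coeff₂_sub, coeff₂_jet, if_pos hij, sub_self]
  have : (fun z : ℂ × ℂ => q.evalEval z.1 z.2) =O[𝓝 0] fun z => ‖z‖ ^ n := by
    simp only [evalEval_eq_sum]
    refine IsBigO.fun_sum fun j _ => IsBigO.fun_sum fun i _ => ?_
    by_cases hij : i + j < n
    · simpa [hq0 i j hij] using isBigO_zero _ _
    · simp only [mul_assoc]
      exact ((pow_mul_pow_isBigO i j).const_mul_left _).trans (norm_pow_isBigO (not_lt.1 hij))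
  refine (IsBigO.add hp this).congr_left fun z => ?_
  rw [hq, evalEval_sub]; ring

theorem eq_zero_of_sum_pow_isBigO (n : ℕ) (d : ℕ → ℂ)
    (h : (fun t : ℂ => ∑ m ∈ Finset.range n, d m * t ^ m) =O[𝓝 0] fun t => ‖t‖ ^ n) :
    ∀ m < n, d m = 0 := by
  induction n with
  | zero => simp
  | succ n ih =>
    have hpow : (fun t : ℂ => ‖t‖ ^ (n + 1)) =O[𝓝 0] fun t => ‖t‖ ^ n := by
      have : (fun t : ℂ => ‖t‖) =O[𝓝 0] fun _ => (1 : ℝ) :=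
        (continuous_norm.tendsto 0).isBigO_one ℝ
      simpa [pow_succ] using (isBigO_refl (fun t : ℂ => ‖t‖ ^ n) (𝓝 0)).mul this
    have htop : (fun t : ℂ => d n * t ^ n) =O[𝓝 0] fun t => ‖t‖ ^ n := by
      refine IsBigO.const_mul_left ?_ _
      exact IsBigO.of_norm_right (IsBigO.of_bound 1 (by simp))
    have hlow : ∀ m < n, d m = 0 := by
      refine ih (((h.trans hpow).sub htop).congr_left fun t => ?_)
      rw [Finset.sum_range_succ, add_sub_cancel_right]
    have hn : d n = 0 := by
      have := IsBigO.continuousMultilinearMap_apply_eq_zero (n := n) (E := ℂ) (F := ℂ) (𝕜 := ℂ)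
        (p := d n • ContinuousMultilinearMap.mkPiAlgebraFin ℂ n ℂ)
        (h.congr_left fun t => by
          rw [Finset.sum_range_succ, Finset.sum_eq_zero fun m hm => by
            rw [hlow m (Finset.mem_range.1 hm), zero_mul]]
          simp) 1
      simpa using this
    intro m hm
    rcases Nat.lt_succ_iff_lt_or_eq.1 hm with hm | rfl
    exacts [hlow m hm, hn]

/-- A polynomial which is `O(‖z‖ ^ n)` has no terms of degree less than `n`: restricted to the
line through `(u, 1)`, it is a polynomial in one variable whose coefficients are polynomials
in `u`. -/
theorem coeff₂_eq_zero_of_approx_zero {n : ℕ} {p : ℂ[X][Y]} (hp : Approx n (fun _ => 0) p)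
    {i j : ℕ} (hij : i + j < n) : coeff₂ p i j = 0 := by
  have key (u : ℂ) : ∀ m < n,
      ∑ s ∈ Finset.HasAntidiagonal.antidiagonal m, coeff₂ p s.1 s.2 * u ^ s.1 = 0 := by
    refine eq_zero_of_sum_pow_isBigO n _ ?_
    have hlim : Tendsto (fun t : ℂ => (u * t, t)) (𝓝 0) (𝓝 (0 : ℂ × ℂ)) := by
      have : Continuous fun t : ℂ => (u * t, t) := by fun_prop
      simpa [Prod.mk_zero_zero] using this.tendsto 0
    have h1 := (IsBigO.comp_tendsto hp.truncate hlim).neg_left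
    have h2 : (fun t : ℂ => ‖(u * t, t)‖ ^ n) =O[𝓝 0] fun t => ‖t‖ ^ n := by
      refine IsBigO.pow (IsBigO.norm_left (IsBigO.norm_right (IsBigO.prod_left ?_ ?_))) n
      · exact (isBigO_refl _ _).const_mul_left u
      · exact isBigO_refl _ _
    refine (h1.trans h2).congr_left fun t => ?_
    simp only [Function.comp, evalEval_jet, zero_sub, neg_neg]
    rw [jet]
    refine Finset.sum_congr rfl fun m _ => ?_
    rw [Finset.sum_mul]
    refine Finset.sum_congr rfl fun s hs => ?_
    rw [← Finset.HasAntidiagonal.mem_antidiagonal.1 hs]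
    simp only [evalEval_C, eval_X, evalEval_X, smul_eq_mul, mul_pow, pow_add]
    ring
  have hpoly : ∑ s ∈ Finset.HasAntidiagonal.antidiagonal (i + j),
      monomial s.1 (coeff₂ p s.1 s.2) = (0 : ℂ[X]) :=
    Polynomial.funext fun u => by
      simpa [eval_finsetSum, eval_monomial] using key u (i + j) hij
  have := congrArg (fun r => r.coeff i) hpoly
  simp only [finsetSum_coeff, coeff_monomial, coeff_zero] at this
  rwa [Finset.sum_eq_single (i, j), if_pos rfl] at this
  · intro s hs hne
    rw [if_neg]
    rintro rfl
    exact hne (Prod.ext rfl (add_left_cancel (Finset.HasAntidiagonal.mem_antidiagonal.1 hs)))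
  · simp

theorem Approx.coeff₂_eq {n : ℕ} {h : ℂ × ℂ → ℂ} {p q : ℂ[X][Y]} (hp : Approx n h p)
    (hq : Approx n h q) {i j : ℕ} (hij : i + j < n) : coeff₂ p i j = coeff₂ q i j := by
  have : Approx n (fun _ => 0) (p - q) := by simpa using hp.sub hq
  rw [← sub_eq_zero, ← coeff₂_sub, coeff₂_eq_zero_of_approx_zero this hij]

/-- Substituting a map without constant term composes the jets. -/
theorem Approx.comp {n : ℕ} {h : ℂ × ℂ → ℂ} {c : ℕ → ℕ → ℂ} {F : ℂ × ℂ → ℂ × ℂ} {P Q : ℂ[X][Y]}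
    (hh : Approx n h (jet n c (C X) Y)) (hF : F =O[𝓝 0] fun z => ‖z‖)
    (hP : Approx n (fun z => (F z).1) P) (hQ : Approx n (fun z => (F z).2) Q) :
    Approx n (fun z => h (F z)) (jet n c P Q) := by
  have hlim : Tendsto F (𝓝 0) (𝓝 0) := hF.trans_tendsto tendsto_norm_zero
  have h1 := (IsBigO.comp_tendsto hh hlim).trans (hF.norm_left.pow n)
  refine (h1.add (hP.jet_apply hQ n c)).congr_left fun z => ?_
  simp [evalEval_jet, evalEval_C]

/-! ### Linearization of periodic maps -/

/-- Let `ℓ` be a function with `ℓ ∘ F = lam • ℓ` to first order. If `F ^ p = id` near the origin and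
`lam ^ p = 1`, then the average `ψ = p⁻¹ ∑_{k<p} lam⁻ᵏ ℓ ∘ F ^ k` satisfies `ψ ∘ F = lam • ψ`
exactly, and agrees with `ℓ` to first order. The conclusion states this for the coefficients `a`
of the `n`-jet of `ψ`. -/
theorem exists_linearizing_jet {n p : ℕ} (hn : 2 ≤ n) (hp : p ≠ 0) {F : ℂ × ℂ → ℂ × ℂ}
    {P Q : ℂ[X][Y]} (hF : F =O[𝓝 0] fun z => ‖z‖) (hP : Approx n (fun z => (F z).1) P)
    (hQ : Approx n (fun z => (F z).2) Q) (hper : ∀ᶠ z in 𝓝 0, F^[p] z = z)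
    {lam : ℂ} (hlam : lam ^ p = 1) {ℓ : ℂ × ℂ → ℂ} {L : ℂ[X][Y]} (hℓ : Approx n ℓ L)
    (hℓF : (fun z => ℓ (F z) - lam * ℓ z) =O[𝓝 0] fun z => ‖z‖ ^ 2) :
    ∃ a : ℕ → ℕ → ℂ, (∀ i j, i + j < n → coeff₂ (jet n a P Q) i j = lam * a i j) ∧
      ∀ i j, i + j < 2 → a i j = coeff₂ L i j := by
  have hlam0 : lam ≠ 0 := by
    rintro rfl
    simp [hp] at hlam
  have hpC : (p : ℂ) ≠ 0 := Nat.cast_ne_zero.2 hp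
  have hlim : Tendsto F (𝓝 0) (𝓝 0) := hF.trans_tendsto tendsto_norm_zero
  have hiter (k : ℕ) : ∃ q, Approx n (fun z => ℓ (F^[k] z)) q := by
    induction k with
    | zero => exact ⟨L, hℓ⟩
    | succ k ih =>
      obtain ⟨q, hq⟩ := ih
      exact ⟨_, hq.truncate.comp hF hP hQ⟩
  have hlin (k : ℕ) : (fun z => ℓ (F^[k] z) - lam ^ k * ℓ z) =O[𝓝 0] fun z => ‖z‖ ^ 2 := by
    induction k with
    | zero => simpa using isBigO_zero _ _
    | succ k ih =>
      have h1 := (ih.comp_tendsto hlim).trans (hF.norm_left.pow 2)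
      refine (h1.add (hℓF.const_mul_left (lam ^ k))).congr_left fun z => ?_
      simp only [Function.comp_apply, Function.iterate_succ_apply]
      ring
  choose q hq using hiter
  set ψ : ℂ × ℂ → ℂ := fun z =>
    (p : ℂ)⁻¹ * ∑ k ∈ Finset.range p, (lam ^ k)⁻¹ * ℓ (F^[k] z) with hψ
  have hψq : ∃ r, Approx n ψ r :=
    ⟨_, (Approx.sum (Finset.range p) fun k _ => (hq k).smul (lam ^ k)⁻¹).smul (p : ℂ)⁻¹⟩
  obtain ⟨r, hr⟩ := hψq
  have hψF : ∀ᶠ z in 𝓝 0, ψ (F z) = lam * ψ z := by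
    filter_upwards [hper] with z hz
    have h1 : ∑ k ∈ Finset.range p, (lam ^ (k + 1))⁻¹ * ℓ (F^[k + 1] z) =
        ∑ k ∈ Finset.range p, (lam ^ k)⁻¹ * ℓ (F^[k] z) := by
      have h2 := Finset.sum_range_succ' (fun k => (lam ^ k)⁻¹ * ℓ (F^[k] z)) p
      rw [Finset.sum_range_succ, hz, hlam] at h2
      simpa using h2.symm
    simp only [hψ]
    rw [mul_left_comm, ← h1, Finset.mul_sum _ _ lam]
    congr 1
    refine Finset.sum_congr rfl fun k _ => ?_
    rw [Function.iterate_succ_apply, pow_succ]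
    field_simp
  have hψℓ : Approx 2 ψ L := by
    have h1 : (fun z => ψ z - ℓ z) =O[𝓝 0] fun z => ‖z‖ ^ 2 := by
      have h2 := IsBigO.fun_sum (s := Finset.range p) fun k _ => (hlin k).const_mul_left (lam ^ k)⁻¹
      refine (h2.const_mul_left (p : ℂ)⁻¹).congr_left fun z => ?_
      have h3 (k : ℕ) : (lam ^ k)⁻¹ * (ℓ (F^[k] z) - lam ^ k * ℓ z) =
          (lam ^ k)⁻¹ * ℓ (F^[k] z) - ℓ z := by
        field_simp
      simp only [h3, hψ, Finset.sum_sub_distrib, Finset.sum_const, Finset.card_range, nsmul_eq_mul]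
      field_simp
    exact (h1.add (hℓ.mono hn)).congr_left fun z => by ring
  refine ⟨coeff₂ r, fun i j hij => ?_, fun i j hij => (hr.mono hn).coeff₂_eq hψℓ hij⟩
  have h1 : Approx n (fun z => ψ (F z)) (lam • r) :=
    IsBigO.congr' (hr.smul lam) (hψF.mono fun z hz => by simp only [hz]) EventuallyEq.rfl
  rw [(hr.truncate.comp hF hP hQ).coeff₂_eq h1 hij, coeff₂_smul]

/-! ### Coefficients of a composite jet -/

/-- `coeff₂_mul` written out for the indices below that occur in computing the coefficient of
`x ^ 3 * y ^ 2` and those of degree at most `4` other than that of `y ^ 4`. -/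
theorem coeff₂_mul_low (p q : ℂ[X][Y]) :
    coeff₂ (p * q) 0 0 = coeff₂ p 0 0 * coeff₂ q 0 0 ∧
    coeff₂ (p * q) 1 0 = coeff₂ p 0 0 * coeff₂ q 1 0 + coeff₂ p 1 0 * coeff₂ q 0 0 ∧
    coeff₂ (p * q) 0 1 = coeff₂ p 0 0 * coeff₂ q 0 1 + coeff₂ p 0 1 * coeff₂ q 0 0 ∧
    coeff₂ (p * q) 2 0 = coeff₂ p 0 0 * coeff₂ q 2 0 + coeff₂ p 1 0 * coeff₂ q 1 0
      + coeff₂ p 2 0 * coeff₂ q 0 0 ∧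
    coeff₂ (p * q) 1 1 = coeff₂ p 0 0 * coeff₂ q 1 1 + coeff₂ p 0 1 * coeff₂ q 1 0
      + coeff₂ p 1 0 * coeff₂ q 0 1 + coeff₂ p 1 1 * coeff₂ q 0 0 ∧
    coeff₂ (p * q) 0 2 = coeff₂ p 0 0 * coeff₂ q 0 2 + coeff₂ p 0 1 * coeff₂ q 0 1
      + coeff₂ p 0 2 * coeff₂ q 0 0 ∧
    coeff₂ (p * q) 3 0 = coeff₂ p 0 0 * coeff₂ q 3 0 + coeff₂ p 1 0 * coeff₂ q 2 0
      + coeff₂ p 2 0 * coeff₂ q 1 0 + coeff₂ p 3 0 * coeff₂ q 0 0 ∧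
    coeff₂ (p * q) 2 1 = coeff₂ p 0 0 * coeff₂ q 2 1 + coeff₂ p 0 1 * coeff₂ q 2 0
      + coeff₂ p 1 0 * coeff₂ q 1 1 + coeff₂ p 1 1 * coeff₂ q 1 0 + coeff₂ p 2 0 * coeff₂ q 0 1
      + coeff₂ p 2 1 * coeff₂ q 0 0 ∧
    coeff₂ (p * q) 1 2 = coeff₂ p 0 0 * coeff₂ q 1 2 + coeff₂ p 0 1 * coeff₂ q 1 1
      + coeff₂ p 0 2 * coeff₂ q 1 0 + coeff₂ p 1 0 * coeff₂ q 0 2 + coeff₂ p 1 1 * coeff₂ q 0 1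
      + coeff₂ p 1 2 * coeff₂ q 0 0 ∧
    coeff₂ (p * q) 0 3 = coeff₂ p 0 0 * coeff₂ q 0 3 + coeff₂ p 0 1 * coeff₂ q 0 2
      + coeff₂ p 0 2 * coeff₂ q 0 1 + coeff₂ p 0 3 * coeff₂ q 0 0 ∧
    coeff₂ (p * q) 4 0 = coeff₂ p 0 0 * coeff₂ q 4 0 + coeff₂ p 1 0 * coeff₂ q 3 0
      + coeff₂ p 2 0 * coeff₂ q 2 0 + coeff₂ p 3 0 * coeff₂ q 1 0 + coeff₂ p 4 0 * coeff₂ q 0 0 ∧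
    coeff₂ (p * q) 3 1 = coeff₂ p 0 0 * coeff₂ q 3 1 + coeff₂ p 0 1 * coeff₂ q 3 0
      + coeff₂ p 1 0 * coeff₂ q 2 1 + coeff₂ p 1 1 * coeff₂ q 2 0 + coeff₂ p 2 0 * coeff₂ q 1 1
      + coeff₂ p 2 1 * coeff₂ q 1 0 + coeff₂ p 3 0 * coeff₂ q 0 1 + coeff₂ p 3 1 * coeff₂ q 0 0 ∧
    coeff₂ (p * q) 2 2 = coeff₂ p 0 0 * coeff₂ q 2 2 + coeff₂ p 0 1 * coeff₂ q 2 1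
      + coeff₂ p 0 2 * coeff₂ q 2 0 + coeff₂ p 1 0 * coeff₂ q 1 2 + coeff₂ p 1 1 * coeff₂ q 1 1
      + coeff₂ p 1 2 * coeff₂ q 1 0 + coeff₂ p 2 0 * coeff₂ q 0 2 + coeff₂ p 2 1 * coeff₂ q 0 1
      + coeff₂ p 2 2 * coeff₂ q 0 0 ∧
    coeff₂ (p * q) 1 3 = coeff₂ p 0 0 * coeff₂ q 1 3 + coeff₂ p 0 1 * coeff₂ q 1 2
      + coeff₂ p 0 2 * coeff₂ q 1 1 + coeff₂ p 0 3 * coeff₂ q 1 0 + coeff₂ p 1 0 * coeff₂ q 0 3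
      + coeff₂ p 1 1 * coeff₂ q 0 2 + coeff₂ p 1 2 * coeff₂ q 0 1 + coeff₂ p 1 3 * coeff₂ q 0 0 ∧
    coeff₂ (p * q) 3 2 = coeff₂ p 0 0 * coeff₂ q 3 2 + coeff₂ p 0 1 * coeff₂ q 3 1
      + coeff₂ p 0 2 * coeff₂ q 3 0 + coeff₂ p 1 0 * coeff₂ q 2 2 + coeff₂ p 1 1 * coeff₂ q 2 1
      + coeff₂ p 1 2 * coeff₂ q 2 0 + coeff₂ p 2 0 * coeff₂ q 1 2 + coeff₂ p 2 1 * coeff₂ q 1 1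
      + coeff₂ p 2 2 * coeff₂ q 1 0 + coeff₂ p 3 0 * coeff₂ q 0 2 + coeff₂ p 3 1 * coeff₂ q 0 1
      + coeff₂ p 3 2 * coeff₂ q 0 0 := by
  refine ⟨?_, ?_, ?_, ?_, ?_, ?_, ?_, ?_, ?_, ?_, ?_, ?_, ?_, ?_, ?_⟩ <;>
    simp [coeff₂_mul, Finset.sum_range_succ, add_assoc]

theorem jet_six {A : Type*} [CommRing A] [Algebra ℂ A] {a : ℕ → ℕ → ℂ} (a00 : a 0 0 = 0)
    (x y : A) :
    jet 6 a x y = a 1 0 • x + a 0 1 • y + a 2 0 • (x * x) + a 1 1 • (x * y) + a 0 2 • (y * y)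
      + a 3 0 • (x * x * x) + a 2 1 • (x * x * y) + a 1 2 • (x * y * y) + a 0 3 • (y * y * y)
      + a 4 0 • (x * x * x * x) + a 3 1 • (x * x * x * y) + a 2 2 • (x * x * y * y)
      + a 1 3 • (x * y * y * y) + a 0 4 • (y * y * y * y) + a 5 0 • (x * x * x * x * x)
      + a 4 1 • (x * x * x * x * y) + a 3 2 • (x * x * x * y * y) + a 2 3 • (x * x * y * y * y)
      + a 1 4 • (x * y * y * y * y) + a 0 5 • (y * y * y * y * y) := by
  simp [jet, Finset.sum_range_succ, Finset.Nat.antidiagonal_succ, a00, pow_succ, mul_assoc]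
  abel

/-- Coefficients of `∑ a i j P ^ i Q ^ j`, where `P = α x + ⋯` has the coefficients `f` and
`Q = y + ⋯` the coefficients `α g`. For a map with linear part `(α x, α⁻¹ y)` this `Q` is `α` times
the second component, which keeps negative powers of `α` out of the formulas. -/
theorem coeff₂_jet_six {α : ℂ} {f g a : ℕ → ℕ → ℂ} {P Q : ℂ[X][Y]}
    (P00 : coeff₂ P 0 0 = 0) (P10 : coeff₂ P 1 0 = α) (P01 : coeff₂ P 0 1 = 0)
    (hP : ∀ i j, 2 ≤ i + j → i + j < 6 → coeff₂ P i j = f i j)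
    (Q00 : coeff₂ Q 0 0 = 0) (Q10 : coeff₂ Q 1 0 = 0) (Q01 : coeff₂ Q 0 1 = 1)
    (hQ : ∀ i j, 2 ≤ i + j → i + j < 6 → coeff₂ Q i j = α * g i j)
    (a00 : a 0 0 = 0) :
    coeff₂ (jet 6 a P Q) 2 0 = a 1 0 * f 2 0 + a 0 1 * g 2 0 * α + a 2 0 * α ^ 2 ∧
    coeff₂ (jet 6 a P Q) 1 1 = a 1 0 * f 1 1 + a 0 1 * g 1 1 * α + a 1 1 * α ∧
    coeff₂ (jet 6 a P Q) 0 2 = a 1 0 * f 0 2 + a 0 1 * g 0 2 * α + a 0 2 ∧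
    coeff₂ (jet 6 a P Q) 3 0 = a 1 0 * f 3 0 + a 0 1 * g 3 0 * α + 2 * a 2 0 * f 2 0 * α + a 1 1
        * g 2 0 * α ^ 2 + a 3 0 * α ^ 3 ∧
    coeff₂ (jet 6 a P Q) 2 1 = a 1 0 * f 2 1 + a 0 1 * g 2 1 * α + 2 * a 2 0 * f 1 1 * α + a 1 1
        * (f 2 0 + g 1 1 * α ^ 2) + 2 * a 0 2 * g 2 0 * α + a 2 1 * α ^ 2 ∧
    coeff₂ (jet 6 a P Q) 1 2 = a 1 0 * f 1 2 + a 0 1 * g 1 2 * α + 2 * a 2 0 * f 0 2 * α + a 1 1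
        * (f 1 1 + g 0 2 * α ^ 2) + 2 * a 0 2 * g 1 1 * α + a 1 2 * α ∧
    coeff₂ (jet 6 a P Q) 0 3 = a 1 0 * f 0 3 + a 0 1 * g 0 3 * α + a 1 1 * f 0 2 + 2 * a 0 2
        * g 0 2 * α + a 0 3 ∧
    coeff₂ (jet 6 a P Q) 4 0 = a 1 0 * f 4 0 + a 0 1 * g 4 0 * α + a 2 0 * (f 2 0 ^ 2 + 2 * f 3 0
        * α) + a 1 1 * (g 3 0 * α ^ 2 + f 2 0 * g 2 0 * α) + a 0 2 * g 2 0 ^ 2 * α ^ 2 + 3 * a 3 0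
        * f 2 0 * α ^ 2 + a 2 1 * g 2 0 * α ^ 3 + a 4 0 * α ^ 4 ∧
    coeff₂ (jet 6 a P Q) 3 1 = a 1 0 * f 3 1 + a 0 1 * g 3 1 * α + a 2 0 * (2 * f 1 1 * f 2 0 + 2
        * f 2 1 * α) + a 1 1 * (f 3 0 + g 2 1 * α ^ 2 + f 1 1 * g 2 0 * α + f 2 0 * g 1 1 * α)
        + a 0 2 * (2 * g 3 0 * α + 2 * g 1 1 * g 2 0 * α ^ 2) + 3 * a 3 0 * f 1 1 * α ^ 2 + a 2 1
        * (2 * f 2 0 * α + g 1 1 * α ^ 3) + 2 * a 1 2 * g 2 0 * α ^ 2 + a 3 1 * α ^ 3 ∧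
    coeff₂ (jet 6 a P Q) 2 2 = a 1 0 * f 2 2 + a 0 1 * g 2 2 * α + a 2 0 * (f 1 1 ^ 2 + 2 * f 0 2
        * f 2 0 + 2 * f 1 2 * α) + a 1 1 * (f 2 1 + g 1 2 * α ^ 2 + f 0 2 * g 2 0 * α + f 1 1
        * g 1 1 * α + f 2 0 * g 0 2 * α) + a 0 2 * (g 1 1 ^ 2 * α ^ 2 + 2 * g 2 1 * α + 2 * g 0 2
        * g 2 0 * α ^ 2) + 3 * a 3 0 * f 0 2 * α ^ 2 + a 2 1 * (2 * f 1 1 * α + g 0 2 * α ^ 3)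
        + a 1 2 * (f 2 0 + 2 * g 1 1 * α ^ 2) + 3 * a 0 3 * g 2 0 * α + a 2 2 * α ^ 2 ∧
    coeff₂ (jet 6 a P Q) 1 3 = a 1 0 * f 1 3 + a 0 1 * g 1 3 * α + a 2 0 * (2 * f 0 2 * f 1 1 + 2
        * f 0 3 * α) + a 1 1 * (f 1 2 + g 0 3 * α ^ 2 + f 0 2 * g 1 1 * α + f 1 1 * g 0 2 * α)
        + a 0 2 * (2 * g 1 2 * α + 2 * g 0 2 * g 1 1 * α ^ 2) + 2 * a 2 1 * f 0 2 * α + a 1 2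
        * (f 1 1 + 2 * g 0 2 * α ^ 2) + 3 * a 0 3 * g 1 1 * α + a 1 3 * α ∧
    coeff₂ (jet 6 a P Q) 3 2 = a 1 0 * f 3 2 + a 0 1 * g 3 2 * α + a 2 0 * (2 * f 0 2 * f 3 0 + 2
        * f 1 1 * f 2 1 + 2 * f 1 2 * f 2 0 + 2 * f 2 2 * α) + a 1 1 * (f 3 1 + g 2 2 * α ^ 2
        + f 0 2 * g 3 0 * α + f 1 1 * g 2 1 * α + f 1 2 * g 2 0 * α + f 2 0 * g 1 2 * α + f 2 1
        * g 1 1 * α + f 3 0 * g 0 2 * α) + a 0 2 * (2 * g 3 1 * α + 2 * g 0 2 * g 3 0 * α ^ 2 + 2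
        * g 1 1 * g 2 1 * α ^ 2 + 2 * g 1 2 * g 2 0 * α ^ 2) + a 3 0 * (3 * f 1 1 ^ 2 * α + 3
        * f 1 2 * α ^ 2 + 6 * f 0 2 * f 2 0 * α) + a 2 1 * (2 * f 1 1 * f 2 0 + 2 * f 2 1 * α
        + g 1 2 * α ^ 3 + 2 * f 0 2 * g 2 0 * α ^ 2 + 2 * f 1 1 * g 1 1 * α ^ 2 + 2 * f 2 0
        * g 0 2 * α ^ 2) + a 1 2 * (f 3 0 + g 1 1 ^ 2 * α ^ 3 + 2 * g 2 1 * α ^ 2 + 2 * f 1 1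
        * g 2 0 * α + 2 * f 2 0 * g 1 1 * α + 2 * g 0 2 * g 2 0 * α ^ 3) + a 0 3 * (3 * g 3 0 * α
        + 6 * g 1 1 * g 2 0 * α ^ 2) + 4 * a 4 0 * f 0 2 * α ^ 3 + a 3 1 * (3 * f 1 1 * α ^ 2
        + g 0 2 * α ^ 4) + a 2 2 * (2 * f 2 0 * α + 2 * g 1 1 * α ^ 3) + 3 * a 1 3 * g 2 0 * α ^ 2
        + a 3 2 * α ^ 3 := by
  have P20 := hP 2 0 (by norm_num) (by norm_num)
  have P11 := hP 1 1 (by norm_num) (by norm_num)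
  have P02 := hP 0 2 (by norm_num) (by norm_num)
  have P30 := hP 3 0 (by norm_num) (by norm_num)
  have P21 := hP 2 1 (by norm_num) (by norm_num)
  have P12 := hP 1 2 (by norm_num) (by norm_num)
  have P03 := hP 0 3 (by norm_num) (by norm_num)
  have P40 := hP 4 0 (by norm_num) (by norm_num)
  have P31 := hP 3 1 (by norm_num) (by norm_num)
  have P22 := hP 2 2 (by norm_num) (by norm_num)
  have P13 := hP 1 3 (by norm_num) (by norm_num)
  have P32 := hP 3 2 (by norm_num) (by norm_num)
  have Q20 := hQ 2 0 (by norm_num) (by norm_num)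
  have Q11 := hQ 1 1 (by norm_num) (by norm_num)
  have Q02 := hQ 0 2 (by norm_num) (by norm_num)
  have Q30 := hQ 3 0 (by norm_num) (by norm_num)
  have Q21 := hQ 2 1 (by norm_num) (by norm_num)
  have Q12 := hQ 1 2 (by norm_num) (by norm_num)
  have Q03 := hQ 0 3 (by norm_num) (by norm_num)
  have Q40 := hQ 4 0 (by norm_num) (by norm_num)
  have Q31 := hQ 3 1 (by norm_num) (by norm_num)
  have Q22 := hQ 2 2 (by norm_num) (by norm_num)
  have Q13 := hQ 1 3 (by norm_num) (by norm_num)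
  have Q32 := hQ 3 2 (by norm_num) (by norm_num)
  rw [jet_six a00]
  refine ⟨?_, ?_, ?_, ?_, ?_, ?_, ?_, ?_, ?_, ?_, ?_, ?_⟩ <;>
    simp only [coeff₂_add, coeff₂_smul, coeff₂_mul_low, mul_zero, zero_mul, add_zero, zero_add,
      mul_one, one_mul, P00, P10, P01, P20, P11, P02, P30, P21, P12, P03, P40, P31, P22, P13,
      P32, Q00, Q10, Q01, Q20, Q11, Q02, Q30, Q21, Q12, Q03, Q40, Q31, Q22, Q13, Q32] <;>
    ring

/-! ### Elimination of the coefficients of the linearization -/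

section Elimination

variable {α : ℂ} {f g : ℕ → ℕ → ℂ} {P Q : ℂ[X][Y]}

/-- In the presence of an eigenfunction `∑ a i j x ^ i (α y) ^ j` with linear part `x` and
eigenvalue `α`, the polynomial `P1` vanishes and `P3` is a multiple of `P2`. -/
theorem P1_eq_zero_and_P3_eq (P00 : coeff₂ P 0 0 = 0) (P10 : coeff₂ P 1 0 = α)
    (P01 : coeff₂ P 0 1 = 0) (hP : ∀ i j, 2 ≤ i + j → i + j < 6 → coeff₂ P i j = f i j)
    (Q00 : coeff₂ Q 0 0 = 0) (Q10 : coeff₂ Q 1 0 = 0) (Q01 : coeff₂ Q 0 1 = 1)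
    (hQ : ∀ i j, 2 ≤ i + j → i + j < 6 → coeff₂ Q i j = α * g i j)
    {a : ℕ → ℕ → ℂ} (a00 : a 0 0 = 0) (a10 : a 1 0 = 1) (a01 : a 0 1 = 0)
    (ha : ∀ i j, i + j < 6 → coeff₂ (jet 6 a P Q) i j = α * (α ^ j * a i j)) :
    P1 α f g = 0 ∧ P3 α f g = α ^ 6 * (1 + α + α ^ 2) * (1 - α ^ 4) *
      ((1 - α ^ 3) * (a 2 1 - 3 * a 1 1 * a 2 0) - α * (1 + α + α ^ 2) * a 1 1 * g 1 1
        - 2 * α ^ 2 * a 0 2 * g 2 0) * P2 α f g := by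
  obtain ⟨c20, c11, c02, c30, c21, c12, c03, c40, c31, c22, c13, c32⟩ :=
    coeff₂_jet_six P00 P10 P01 hP Q00 Q10 Q01 hQ a00
  rw [ha _ _ (by norm_num)] at c20 c11 c02 c30 c21 c12 c03 c40 c31 c22 c13 c32
  -- This solves each relation for the coefficient of `P`, as `α ^ (j + 1) * a i j - ⋯ = f i j`.
  simp only [a10, a01, one_mul, zero_mul, add_zero, ← sub_eq_iff_eq_add]
    at c20 c11 c02 c30 c21 c12 c03 c40 c31 c22 c13 c32
  constructor
  · simp only [P1]
    rw [← c21, ← c20, ← c11, ← c02]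
    ring
  · simp only [P3, P2, p3Coeff0, p3Coeff1, p3Coeff2, p3Coeff3, p3Coeff4, p3Coeff5, p3Coeff6,
      p3Coeff7, p3Coeff8, p3Coeff9, p3Coeff10, p3Coeff11, p3Coeff12, p3Coeff13, p3Coeff14,
      p3Coeff15, p3Coeff16, p3Coeff17]
    -- Top degree first: the expression for `f i j` involves only `f k l` of lower degree.
    rw [← c32, ← c40, ← c31, ← c22, ← c13, ← c30, ← c21, ← c12, ← c03, ← c20, ← c11, ← c02]
    ring

/-- An eigenfunction `∑ b i j x ^ i (α y) ^ j` with linear part `y` and eigenvalue `α⁻¹` makes `P2`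
vanish. The coefficient `b 1 2` cancels from the relation in bidegree `(1, 2)`, and the
quadratic coefficients are eliminated using `1 - α ^ 3 = (1 - α) * (1 + α + α ^ 2)`. -/
theorem P2_eq_zero (hα : α ≠ 0) (P00 : coeff₂ P 0 0 = 0) (P10 : coeff₂ P 1 0 = α)
    (P01 : coeff₂ P 0 1 = 0) (hP : ∀ i j, 2 ≤ i + j → i + j < 6 → coeff₂ P i j = f i j)
    (Q00 : coeff₂ Q 0 0 = 0) (Q10 : coeff₂ Q 1 0 = 0) (Q01 : coeff₂ Q 0 1 = 1)
    (hQ : ∀ i j, 2 ≤ i + j → i + j < 6 → coeff₂ Q i j = α * g i j)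
    {b : ℕ → ℕ → ℂ} (b00 : b 0 0 = 0) (b10 : b 1 0 = 0) (b01 : α * b 0 1 = 1)
    (hb : ∀ i j, i + j < 6 → α * coeff₂ (jet 6 b P Q) i j = α ^ j * b i j) :
    P2 α f g = 0 := by
  obtain ⟨c20, c11, c02, -, -, c12, -⟩ := coeff₂_jet_six P00 P10 P01 hP Q00 Q10 Q01 hQ b00
  have h20 := hb 2 0 (by norm_num)
  have h11 := hb 1 1 (by norm_num)
  have h02 := hb 0 2 (by norm_num)
  have h12 := hb 1 2 (by norm_num)
  rw [c20, b10] at h20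
  rw [c11, b10] at h11
  rw [c02, b10] at h02
  rw [c12, b10] at h12
  have e20 : α * g 2 0 = (1 - α ^ 3) * b 2 0 := by
    linear_combination h20 - g 2 0 * α * b01
  have e11 : g 1 1 = (1 - α) * b 1 1 := mul_left_cancel₀ hα <| by
    linear_combination h11 - g 1 1 * α * b01
  have e02 : g 0 2 = (α - 1) * b 0 2 := mul_left_cancel₀ hα <| by
    linear_combination h02 - g 0 2 * α * b01
  have e12 : g 1 2 + 2 * α * f 0 2 * b 2 0 + b 1 1 * (f 1 1 + g 0 2 * α ^ 2)
      + 2 * α * b 0 2 * g 1 1 = 0 := mul_left_cancel₀ hα <| by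
    linear_combination h12 - g 1 2 * α * b01
  simp only [P2]
  linear_combination (1 - α ^ 3) * e12 + 2 * α * f 0 2 * e20 +
    (f 1 1 + g 0 2 * α ^ 2) * (1 + α + α ^ 2) * e11 - 2 * α * (1 + α + α ^ 2) * g 1 1 * e02

end Elimination

/-! ### Taylor expansions and the periodicity polynomials -/

/-- The coefficients of `u x + v y + ∑_{i+j≥2} c i j x^i y^j`. -/
def withLinearPart (u v : ℂ) (c : ℕ → ℕ → ℂ) (i j : ℕ) : ℂ :=
  if 2 ≤ i + j then c i j else if i = 1 then u else if j = 1 then v else 0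

theorem jet_withLinearPart (u v : ℂ) (c : ℕ → ℕ → ℂ) (z : ℂ × ℂ) :
    jet 6 (withLinearPart u v c) z.1 z.2 = u * z.1 + v * z.2 + higherTerms c 5 z := by
  have h : Finset.range 6 = {0, 1} ∪ Finset.Icc 2 5 := by decide
  rw [jet, h, Finset.sum_union (by decide), higherTerms]
  congr 1
  · simp [withLinearPart, Finset.Nat.antidiagonal_succ]
    ring
  · refine Finset.sum_congr rfl fun m hm => Finset.sum_congr rfl fun ij hij => ?_
    have : 2 ≤ ij.1 + ij.2 := by
      rw [Finset.HasAntidiagonal.mem_antidiagonal.1 hij]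
      exact (Finset.mem_Icc.1 hm).1
    rw [withLinearPart, if_pos this, smul_eq_mul, mul_assoc]

theorem coeff₂_jet_withLinearPart {u v : ℂ} {c : ℕ → ℕ → ℂ} {i j : ℕ} (h2 : 2 ≤ i + j)
    (h6 : i + j < 6) : coeff₂ (jet 6 (withLinearPart u v c) (C X) Y) i j = c i j := by
  rw [coeff₂_jet, if_pos h6, withLinearPart, if_pos h2]

namespace HasTaylorExpansion

variable {F : ℂ × ℂ → ℂ × ℂ} {α : ℂ} {f g : ℕ → ℕ → ℂ}

theorem approx_fst (h : HasTaylorExpansion F α f g) :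
    Approx 6 (fun z => (F z).1) (jet 6 (withLinearPart α 0 f) (C X) Y) := by
  refine (IsBigO.prod_left_fst (h 5)).congr_left fun z => ?_
  simp [evalEval_jet, evalEval_C, jet_withLinearPart]

theorem approx_snd (h : HasTaylorExpansion F α f g) :
    Approx 6 (fun z => (F z).2) (jet 6 (withLinearPart 0 α⁻¹ g) (C X) Y) := by
  refine (IsBigO.prod_left_snd (h 5)).congr_left fun z => ?_
  simp [evalEval_jet, evalEval_C, jet_withLinearPart]

theorem fst_sub_isBigO (h : HasTaylorExpansion F α f g) :
    (fun z => (F z).1 - α * z.1) =O[𝓝 0] fun z => ‖z‖ ^ 2 := by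
  refine (IsBigO.prod_left_fst (h 1)).congr_left fun z => ?_
  simp [higherTerms]

theorem snd_sub_isBigO (h : HasTaylorExpansion F α f g) :
    (fun z => (F z).2 - α⁻¹ * z.2) =O[𝓝 0] fun z => ‖z‖ ^ 2 := by
  refine (IsBigO.prod_left_snd (h 1)).congr_left fun z => ?_
  simp [higherTerms]

theorem isBigO_norm (h : HasTaylorExpansion F α f g) : F =O[𝓝 0] fun z => ‖z‖ := by
  have hsq : (fun z : ℂ × ℂ => ‖z‖ ^ 2) =O[𝓝 0] fun z => ‖z‖ := by
    simpa using norm_pow_isBigO one_le_two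
  have h1 : (fun z => (F z).1) =O[𝓝 0] fun z => ‖z‖ :=
    ((h.fst_sub_isBigO.trans hsq).add
      (isBigO_fst_prod'.norm_right.const_mul_left α)).congr_left fun z => by simp
  have h2 : (fun z => (F z).2) =O[𝓝 0] fun z => ‖z‖ :=
    ((h.snd_sub_isBigO.trans hsq).add
      (isBigO_snd_prod'.norm_right.const_mul_left α⁻¹)).congr_left fun z => by simp
  exact h1.prod_left h2

end HasTaylorExpansion

/-- Near a fixed point in the interior of the domain all iterates are defined. -/
theorem IterateIsId.eventually_eq {U : Set (ℂ × ℂ)} (hU : U ∈ 𝓝 0) {F : ℂ × ℂ → ℂ × ℂ}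
    (hF : Tendsto F (𝓝 0) (𝓝 0)) {p : ℕ} (h : IterateIsId U F p) :
    ∀ᶠ z in 𝓝 0, F^[p] z = z := by
  have hk : ∀ k ∈ Finset.range p, ∀ᶠ z in 𝓝 0, F^[k] z ∈ U := fun k _ =>
    (hF.iterate k).eventually hU
  filter_upwards [(Finset.eventually_all _).2 hk] with z hz
  exact h z fun k hkp => hz k (Finset.mem_range.2 hkp)

/-- The three polynomials vanish as soon as `F ^ p = id` near the origin with `α ^ p = 1`. -/
theorem P1_P2_P3_eq_zero {p : ℕ} (hp : p ≠ 0) {α : ℂ} (hα : α ^ p = 1) {F : ℂ × ℂ → ℂ × ℂ}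
    {f g : ℕ → ℕ → ℂ} (hfg : HasTaylorExpansion F α f g) (hid : ∀ᶠ z in 𝓝 0, F^[p] z = z) :
    P1 α f g = 0 ∧ P2 α f g = 0 ∧ P3 α f g = 0 := by
  have hα0 : α ≠ 0 := by
    rintro rfl
    simp [hp] at hα
  obtain ⟨a, ha, ha1⟩ := exists_linearizing_jet (n := 6) (by norm_num) hp hfg.isBigO_norm
    hfg.approx_fst hfg.approx_snd hid hα (ℓ := Prod.fst) (L := C X)
    (by simpa [evalEval_C] using approx_eval 6 (C X)) hfg.fst_sub_isBigO
  obtain ⟨b, hb, hb1⟩ := exists_linearizing_jet (n := 6) (by norm_num) hp hfg.isBigO_norm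
    hfg.approx_fst hfg.approx_snd hid (lam := α⁻¹) (by rw [inv_pow, hα, inv_one])
    (ℓ := Prod.snd) (L := Y) (by simpa using approx_eval 6 Y) hfg.snd_sub_isBigO
  set P := jet 6 (withLinearPart α 0 f) (C X : ℂ[X][Y]) Y with hP
  set Q := jet 6 (withLinearPart 0 α⁻¹ g) (C X : ℂ[X][Y]) Y with hQ
  -- Passing from `Q` to `α • Q` rescales the coefficient of `x ^ i * y ^ j` by `α ^ j`.
  have hscale (c : ℕ → ℕ → ℂ) : jet 6 (fun i j => c i j / α ^ j) P (α • Q) = jet 6 c P Q := by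
    rw [jet_smul_right]
    congr 1
    ext i j
    field_simp
  have P00 : coeff₂ P 0 0 = 0 := by simp [hP, coeff₂_jet, withLinearPart]
  have P10 : coeff₂ P 1 0 = α := by simp [hP, coeff₂_jet, withLinearPart]
  have P01 : coeff₂ P 0 1 = 0 := by simp [hP, coeff₂_jet, withLinearPart]
  have hP2 (i j : ℕ) (h2 : 2 ≤ i + j) (h6 : i + j < 6) : coeff₂ P i j = f i j :=
    coeff₂_jet_withLinearPart h2 h6
  have Q00 : coeff₂ (α • Q) 0 0 = 0 := by simp [hQ, coeff₂_smul, coeff₂_jet, withLinearPart]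
  have Q10 : coeff₂ (α • Q) 1 0 = 0 := by simp [hQ, coeff₂_smul, coeff₂_jet, withLinearPart]
  have Q01 : coeff₂ (α • Q) 0 1 = 1 := by simp [hQ, coeff₂_smul, coeff₂_jet, withLinearPart, hα0]
  have hQ2 (i j : ℕ) (h2 : 2 ≤ i + j) (h6 : i + j < 6) : coeff₂ (α • Q) i j = α * g i j := by
    rw [coeff₂_smul, hQ, coeff₂_jet_withLinearPart h2 h6]
  have h1 := P1_eq_zero_and_P3_eq P00 P10 P01 hP2 Q00 Q10 Q01 hQ2
    (a := fun i j => a i j / α ^ j) (by simp [ha1, coeff₂]) (by simp [ha1, coeff₂])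
    (by simp [ha1, coeff₂]) fun i j hij => by
      rw [hscale, ha i j hij]
      field_simp
  have h2 := P2_eq_zero hα0 P00 P10 P01 hP2 Q00 Q10 Q01 hQ2
    (b := fun i j => b i j / α ^ j) (by simp [hb1, coeff₂]) (by simp [hb1, coeff₂])
    (by simp [hb1, coeff₂, hα0]) fun i j hij => by
      rw [hscale, hb i j hij]
      field_simp
  exact ⟨h1.1, h2, by rw [h1.2, h2, mul_zero]⟩

end PeriodicMaps

theorem theorem1 (p : ℕ) (hp : 4 ≤ p) (α : ℂ) (hα : IsPrimitiveRoot α p)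
    (U : Set (ℂ × ℂ)) (hU : IsOpen U) (h0 : (0 : ℂ × ℂ) ∈ U)
    (F : ℂ × ℂ → ℂ × ℂ) (hF : ContDiffOn ℂ ∞ F U)
    (f g : ℕ → ℕ → ℂ) (hfg : PeriodicMaps.HasTaylorExpansion F α f g)
    (hper : PeriodicMaps.IsPeriodicOfOrder U F p) :
    PeriodicMaps.P1 α f g = 0 ∧ PeriodicMaps.P2 α f g = 0 ∧
      (5 ≤ p → PeriodicMaps.P3 α f g = 0) := by
  have hp0 : p ≠ 0 := by omega
  have hid := hper.1.2.eventually_eq (hU.mem_nhds h0)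
    (hfg.isBigO_norm.trans_tendsto tendsto_norm_zero)
  have h := PeriodicMaps.P1_P2_P3_eq_zero hp0 hα.pow_eq_one hfg hid
  exact ⟨h.1, h.2.1, fun _ => h.2.2⟩
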